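/- **Setting.** Let $Q=(Q_0,Q_1,h,t)$ be a finite quiver, $(X,\mathcal O_X)$ a commutative ringed space, and $\mathscr M=(\mathscr M_\alpha)_{\alpha\in Q_1}$ an arbitrary family of $\mathcal O_X$-modules. An *$\mathscr M$-twisted representation* of $Q$ consists of $\mathcal O_X$-modules $(\mathcal E_i)_{i\in Q_0}$ and $\mathcal O_X$-linear maps $\varphi_\alpha:\mathscr M_\alpha\otimes_{\mathcal O_X}\mathcal E_{t\alpha}\to\mathcal E_{h\alpha}$; a morphism is a family of $\mathcal O_X$-linear maps $f_i:\mathcal E_i\to\mathcal E_i'$ with $f_{h\alpha}\circ\varphi_\alpha=\varphi'_\alpha\circ(\mathrm{Id}\otimes f_{t\alpha})$ for all $\alpha\in Q_1$. Let $\mathrm{Rep}(\mathscr MQ)$ be the category of $\mathscr M$-twisted representations. Let $\mathcal B=\bigoplus_{i\in Q_0}\mathcal O_X e_i$ with $e_ie_j=\delta_{ij}e_i$. The module $\bigoplus_\alpha\mathscr M_\alpha$ is a $\mathcal B$-bimodule in which, for a section $m$ of $\mathscr M_\alpha$, $e_i m$ is $m$ if $h\alpha=i$ and $0$ otherwise,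 and $m e_i$ is $m$ if $t\alpha=i$ and $0$ otherwise. The *twisted path algebra* $\mathcal T=\mathcal T_{\mathscr M}\mathcal A_Q$ is the tensor algebra of this bimodule over $\mathcal B$. It is a sheaf of $\mathcal O_X$-algebras, and for a path $p=\alpha_1\cdots\alpha_k$ (with $t\alpha_n=h\alpha_{n+1}$) there is a canonical map $\mathscr M_p:=\mathscr M_{\alpha_1}\otimes_{\mathcal O_X}\cdots\otimes_{\mathcal O_X}\mathscr M_{\alpha_k}\to\mathcal T$. Let $\mathcal T\text{-mod}$ be the category of sheaves of left $\mathcal T$-modules. Define functors as follows. * $G:\mathrm{Rep}(\mathscr MQ)\to\mathcal T\text{-mod}$, $G(\mathcal E)=\bigoplus_i\mathcal E_i$, $G(f)=\bigoplus_i f_i$, where $e_i$ acts as the projection to $\mathcal E_i$ and a section $m$ of $\mathscr M_\alpha$ acts by $s\mapsto\varphi_\alpha(m\otimes s_{t\alpha})\in\mathcal E_{h\alpha}$. * $F:\mathcal T\text{-mod}\to\mathrm{Rep}(\mathscr MQ)$, $F(\mathcal N)=\big((e_i\mathcal N)_i,(\varphi_\alpha)_\alpha\big)$, where $\varphi_\alpha:\mathscr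 M_\alpha\otimes e_{t\alpha}\mathcal N\to e_{h\alpha}\mathcal N$ is induced by the action of $\mathcal T$, and $F(g)_i$ is the restriction of $g$ to $e_i\mathcal N$. A *relation* is a finite sum $r=\sum_p m_p$ with $m_p\in\mathscr M_p(X)$, over paths $p$ of length at least $2$ with a common tail $i$ and a common head $j$. A representation $\mathcal E$ *satisfies* $r$ if $\sum_p\psi_{m_p}=0$, where $\psi_{m_p}:\mathcal E_i\to\mathcal E_j$ is given by the action of $m_p\in\mathcal T(X)$ on $G(\mathcal E)$. For a set $\mathcal R$ of relations let $\mathrm{Rep}(\mathscr MQ,\mathcal R)\subseteq\mathrm{Rep}(\mathscr MQ)$ be the full subcategory of the representations satisfying all $r\in\mathcal R$, with inclusion $\iota$. Let $\mathcal I_{\mathcal R}$ be the two-sided ideal sheaf of $\mathcal T$ generated by $\mathcal R$, and let $\pi^*:\mathcal T/\mathcal I_{\mathcal R}\text{-mod}\to\mathcal T\text{-mod}$ be restriction of scalars along the projection $\pi:\mathcal T\to\mathcal T/\mathcal I_{\mathcal R}$. **Theorem.** With no hypothesis on the modules $\mathscr M_\alpha$: 1. The functors $G$ and $F$ are mutually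 quasi-inverse equivalences of categories between $\mathrm{Rep}(\mathscr MQ)$ and $\mathcal T_{\mathscr M}\mathcal A_Q\text{-mod}$. 2. For every set $\mathcal R$ of relations, $\pi^*$ is full and faithful, and there is an equivalence of categories $G_{\mathcal R}:\mathrm{Rep}(\mathscr MQ,\mathcal R)\to\mathcal T_{\mathscr M}\mathcal A_Q/\mathcal I_{\mathcal R}\text{-mod}$, with a quasi-inverse $F_{\mathcal R}$, compatible with $G$ and $F$: there are natural isomorphisms $\pi^*\circ G_{\mathcal R}\cong G\circ\iota$ and $\iota\circ F_{\mathcal R}\cong F\circ\pi^*$. -/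

import Mathlib

open CategoryTheory AlgebraicGeometry TopologicalSpace Opposite MonoidalCategory Limits

universe u

noncomputable section

namespace TwistedQuiver

/-! ### The tensor algebra of a bimodule -/

section BimoduleTensorAlgebra

variable (B W : Type u) [Ring B] [AddCommGroup W] [Module B W] [Module Bᵐᵒᵖ W]

/-- The relations imposed on the free ring on `B ⊔ W` in order to obtain the tensor algebra:
`B` is mapped by a ring homomorphism and `W` by a homomorphism of `B`-bimodules. -/
inductive BimoduleTensorAlgebra.Rel : FreeAlgebra ℤ (B ⊕ W) → FreeAlgebra ℤ (B ⊕ W) → Prop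
  | base_add (b c : B) : Rel (FreeAlgebra.ι ℤ (Sum.inl (b + c)))
      (FreeAlgebra.ι ℤ (Sum.inl b) + FreeAlgebra.ι ℤ (Sum.inl c))
  | base_mul (b c : B) : Rel (FreeAlgebra.ι ℤ (Sum.inl (b * c)))
      (FreeAlgebra.ι ℤ (Sum.inl b) * FreeAlgebra.ι ℤ (Sum.inl c))
  | base_one : Rel (FreeAlgebra.ι ℤ (Sum.inl 1)) 1
  | mod_add (v w : W) : Rel (FreeAlgebra.ι ℤ (Sum.inr (v + w)))
      (FreeAlgebra.ι ℤ (Sum.inr v) + FreeAlgebra.ι ℤ (Sum.inr w))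
  | smul_left (b : B) (w : W) : Rel (FreeAlgebra.ι ℤ (Sum.inr (b • w)))
      (FreeAlgebra.ι ℤ (Sum.inl b) * FreeAlgebra.ι ℤ (Sum.inr w))
  | smul_right (b : B) (w : W) : Rel (FreeAlgebra.ι ℤ (Sum.inr (MulOpposite.op b • w)))
      (FreeAlgebra.ι ℤ (Sum.inr w) * FreeAlgebra.ι ℤ (Sum.inl b))

/-- The tensor algebra `T_B(W) = B ⊕ W ⊕ (W ⊗_B W) ⊕ ⋯` of a `B`-bimodule `W`, as the universal
ring under `B` with a `B`-bimodule homomorphism from `W` (see `BimoduleTensorAlgebra.lift` and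
`BimoduleTensorAlgebra.hom_ext`). -/
def BimoduleTensorAlgebra : Type u := RingQuot (BimoduleTensorAlgebra.Rel B W)

namespace BimoduleTensorAlgebra

instance : Ring (BimoduleTensorAlgebra B W) :=
  inferInstanceAs (Ring (RingQuot (BimoduleTensorAlgebra.Rel B W)))

/-- The canonical ring homomorphism `B → T_B(W)`. -/
def base : B →+* BimoduleTensorAlgebra B W where
  toFun b := RingQuot.mkRingHom (Rel B W) (FreeAlgebra.ι ℤ (Sum.inl b))
  map_one' := (RingQuot.mkRingHom_rel Rel.base_one).trans (map_one _)
  map_mul' b c := (RingQuot.mkRingHom_rel (Rel.base_mul b c)).trans (map_mul _ _ _)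
  map_add' b c := (RingQuot.mkRingHom_rel (Rel.base_add b c)).trans (map_add _ _ _)
  map_zero' := by
    have h := (RingQuot.mkRingHom_rel (Rel.base_add (W := W) (0 : B) 0)).trans (map_add _ _ _)
    rw [add_zero] at h
    exact left_eq_add.mp h

/-- The canonical additive map `W → T_B(W)`. -/
def incl : W →+ BimoduleTensorAlgebra B W :=
  AddMonoidHom.mk' (fun w => RingQuot.mkRingHom (Rel B W) (FreeAlgebra.ι ℤ (Sum.inr w)))
    (fun v w => (RingQuot.mkRingHom_rel (Rel.mod_add v w)).trans (map_add _ _ _))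

variable {B W}

lemma incl_smul (b : B) (w : W) : incl B W (b • w) = base B W b * incl B W w :=
  (RingQuot.mkRingHom_rel (Rel.smul_left b w)).trans (map_mul _ _ _)

lemma incl_op_smul (b : B) (w : W) :
    incl B W (MulOpposite.op b • w) = incl B W w * base B W b :=
  (RingQuot.mkRingHom_rel (Rel.smul_right b w)).trans (map_mul _ _ _)

/-- The universal property of the tensor algebra of a bimodule. -/
def lift {A : Type*} [Ring A] (f : B →+* A) (g : W →+ A)
    (hl : ∀ (b : B) (w : W), g (b • w) = f b * g w)
    (hr : ∀ (b : B) (w : W), g (MulOpposite.op b • w) = g w * f b) :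
    BimoduleTensorAlgebra B W →+* A :=
  RingQuot.lift ⟨(FreeAlgebra.lift ℤ (Sum.elim f g) : FreeAlgebra ℤ (B ⊕ W) →ₐ[ℤ] A).toRingHom, by
    intro x y h
    cases h <;> simp [hl, hr]⟩

section

variable {A : Type*} [Ring A] (f : B →+* A) (g : W →+ A)
    (hl : ∀ (b : B) (w : W), g (b • w) = f b * g w)
    (hr : ∀ (b : B) (w : W), g (MulOpposite.op b • w) = g w * f b)

@[simp] lemma lift_base (b : B) : lift f g hl hr (base B W b) = f b :=
  (RingQuot.lift_mkRingHom_apply _ _ _).trans (by simp)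

@[simp] lemma lift_incl (w : W) : lift f g hl hr (incl B W w) = g w :=
  (RingQuot.lift_mkRingHom_apply _ _ _).trans (by simp)

end

lemma hom_ext {A : Type*} [Ring A] {f g : BimoduleTensorAlgebra B W →+* A}
    (h₁ : ∀ b, f (base B W b) = g (base B W b)) (h₂ : ∀ w, f (incl B W w) = g (incl B W w)) :
    f = g := by
  refine RingQuot.ringQuot_ext f g ?_
  have : ((f.comp (RingQuot.mkRingHom (Rel B W))).toIntAlgHom) =
      ((g.comp (RingQuot.mkRingHom (Rel B W))).toIntAlgHom) := by
    apply FreeAlgebra.hom_ext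
    funext x
    cases x with
    | inl b => exact h₁ b
    | inr w => exact h₂ w
  exact congrArg AlgHom.toRingHom this

end BimoduleTensorAlgebra

end BimoduleTensorAlgebra

/-! ### Modules over a ringed space -/

section RingedSpaces

variable (X : RingedSpace.{u, u})

/-- The structure sheaf of a ringed space, as a sheaf of rings. -/
abbrev structureSheaf : Sheaf (Opens.grothendieckTopology X) RingCat.{u} where
  obj := X.presheaf ⋙ forget₂ CommRingCat RingCat
  property := ((sheafCompose (Opens.grothendieckTopology X)
    (forget₂ CommRingCat RingCat)).obj X.sheaf).property

/-- The category of presheaves of `𝒪_X`-modules. -/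
abbrev OPreMod := PresheafOfModules.{u} (X.presheaf ⋙ forget₂ CommRingCat RingCat)

/-- The category of `𝒪_X`-modules. -/
abbrev OMod := SheafOfModules.{u} (structureSheaf X)

variable {X}

/-- The presheaf of `𝒪_X`-modules underlying an `𝒪_X`-module. -/
abbrev pre (N : OMod X) : OPreMod X := N.val

/-- The `𝒪_X`-module associated with a presheaf of `𝒪_X`-modules. -/
abbrev sheafifyMod : OPreMod X ⥤ OMod X :=
  PresheafOfModules.sheafification (R := structureSheaf X) (𝟙 (X.presheaf ⋙ forget₂ CommRingCat RingCat))

/-- The canonical map from a presheaf of modules to its associated sheaf. -/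
def toSheafifyMod (P : OPreMod X) : P ⟶ pre (sheafifyMod.obj P) :=
  (PresheafOfModules.sheafificationAdjunction (R := structureSheaf X)
    (𝟙 (X.presheaf ⋙ forget₂ CommRingCat RingCat))).unit.app P

/-- The extension of a map from a presheaf of modules to a sheaf of modules. -/
def sheafifyModLift {P : OPreMod X} {N : OMod X} (f : P ⟶ pre N) : sheafifyMod.obj P ⟶ N :=
  ((PresheafOfModules.sheafificationAdjunction (R := structureSheaf X)
    (𝟙 (X.presheaf ⋙ forget₂ CommRingCat RingCat))).homEquiv P N).symm f

/-- The tensor product `A ⊗_{𝒪_X} B`: the sheaf associated with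
`U ↦ A(U) ⊗_{𝒪_X(U)} B(U)`. -/
def tens (A B : OMod X) : OMod X := sheafifyMod.obj (pre A ⊗ pre B)

/-- The map `Id ⊗ f : A ⊗ B → A ⊗ B'`. -/
def tensMap (A : OMod X) {B B' : OMod X} (f : B ⟶ B') : tens A B ⟶ tens A B' :=
  sheafifyMod.map (pre A ◁ f.val)

lemma sheafifyModLift_naturality_left {P Q : OPreMod X} {N : OMod X} (g : P ⟶ Q)
    (f : Q ⟶ pre N) :
    sheafifyModLift (g ≫ f) = sheafifyMod.map g ≫ sheafifyModLift f :=
  (PresheafOfModules.sheafificationAdjunction (R := structureSheaf X)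
    (𝟙 (X.presheaf ⋙ forget₂ CommRingCat RingCat))).homEquiv_naturality_left_symm g f

lemma sheafifyModLift_naturality_right {P : OPreMod X} {N N' : OMod X} (f : P ⟶ pre N)
    (g : N ⟶ N') :
    sheafifyModLift (f ≫ g.val) = sheafifyModLift f ≫ g :=
  (PresheafOfModules.sheafificationAdjunction (R := structureSheaf X)
    (𝟙 (X.presheaf ⋙ forget₂ CommRingCat RingCat))).homEquiv_naturality_right_symm f g

lemma toSheafifyMod_naturality {P Q : OPreMod X} (f : P ⟶ Q) :
    f ≫ toSheafifyMod Q = toSheafifyMod P ≫ (sheafifyMod.map f).val :=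
  (PresheafOfModules.sheafificationAdjunction (R := structureSheaf X)
    (𝟙 (X.presheaf ⋙ forget₂ CommRingCat RingCat))).unit.naturality f

lemma tensMap_id (A B : OMod X) : tensMap A (𝟙 B) = 𝟙 (tens A B) := by
  have : pre A ◁ (𝟙 B : B ⟶ B).val = 𝟙 _ := whiskerLeft_id _ _
  rw [tensMap, this]; exact sheafifyMod.map_id _

lemma tensMap_comp (A : OMod X) {B B' B'' : OMod X} (f : B ⟶ B') (g : B' ⟶ B'') :
    tensMap A (f ≫ g) = tensMap A f ≫ tensMap A g := by
  have : pre A ◁ (f ≫ g).val = pre A ◁ f.val ≫ pre A ◁ g.val := whiskerLeft_comp _ _ _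
  rw [tensMap, this]; exact sheafifyMod.map_comp _ _

/-- Sections of `𝒪_X`. -/
abbrev OSec (U : (Opens X)ᵒᵖ) : Type u := X.presheaf.obj U

/-- Sections of an `𝒪_X`-module. -/
abbrev Sec (N : OMod X) (U : (Opens X)ᵒᵖ) : Type u := (pre N).obj U

/-- Restriction of sections of an `𝒪_X`-module. -/
def res (N : OMod X) {U U' : (Opens X)ᵒᵖ} (f : U ⟶ U') : Sec N U →+ Sec N U' :=
  AddMonoidHom.mk' (fun s => (pre N).map f s) (map_add ((pre N).map f).hom)

lemma res_id (N : OMod X) (U : (Opens X)ᵒᵖ) (s : Sec N U) : res N (𝟙 U) s = s := by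
  change (pre N).map (𝟙 U) s = s
  rw [PresheafOfModules.map_id]; rfl

lemma res_comp (N : OMod X) {U U' U'' : (Opens X)ᵒᵖ} (f : U ⟶ U') (g : U' ⟶ U'') (s : Sec N U) :
    res N (f ≫ g) s = res N g (res N f s) :=
  (pre N).map_comp_apply f g s

lemma res_smul (N : OMod X) {U U' : (Opens X)ᵒᵖ} (f : U ⟶ U') (r : OSec U) (s : Sec N U) :
    res N f (r • s) = (X.presheaf.map f r : OSec U') • res N f s :=
  (pre N).map_smul f r s

/-- The action of a morphism of `𝒪_X`-modules on sections. -/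
def onSec {N N' : OMod X} (g : N ⟶ N') (U : (Opens X)ᵒᵖ) : Sec N U →ₗ[OSec U] Sec N' U :=
  (g.val.app U).hom

lemma onSec_res {N N' : OMod X} (g : N ⟶ N') {U U' : (Opens X)ᵒᵖ} (f : U ⟶ U') (s : Sec N U) :
    onSec g U' (res N f s) = res N' f (onSec g U s) :=
  PresheafOfModules.naturality_apply g.val f s

/-- The pairing `A(U) × B(U) → N(U)`, `(m, s) ↦ φ(m ⊗ s)` associated with `φ : A ⊗ B → N`. -/
def pairing {A B N : OMod X} (φ : tens A B ⟶ N) (U : (Opens X)ᵒᵖ) :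
    Sec A U →ₗ[OSec U] Sec B U →ₗ[OSec U] Sec N U :=
  TensorProduct.curry
    ((toSheafifyMod (pre A ⊗ pre B) ≫ φ.val : pre A ⊗ pre B ⟶ pre N).app U).hom

lemma pairing_res {A B N : OMod X} (φ : tens A B ⟶ N) {U U' : (Opens X)ᵒᵖ} (f : U ⟶ U')
    (m : Sec A U) (s : Sec B U) :
    res N f (pairing φ U m s) = pairing φ U' (res A f m) (res B f s) :=
  (PresheafOfModules.naturality_apply
    (toSheafifyMod (pre A ⊗ pre B) ≫ φ.val : pre A ⊗ pre B ⟶ pre N) f (m ⊗ₜ s)).symm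

lemma pairing_comp {A B N N' : OMod X} (φ : tens A B ⟶ N) (g : N ⟶ N') (U : (Opens X)ᵒᵖ)
    (m : Sec A U) (s : Sec B U) :
    pairing (φ ≫ g) U m s = onSec g U (pairing φ U m s) := rfl

lemma pairing_tensMap_comp {A B B' N : OMod X} (f : B ⟶ B') (φ : tens A B' ⟶ N)
    (U : (Opens X)ᵒᵖ) (m : Sec A U) (s : Sec B U) :
    pairing (tensMap A f ≫ φ) U m s = pairing φ U m (onSec f U s) := by
  have h := congrArg (fun g : pre A ⊗ pre B ⟶ pre (tens A B') => (g.app U).hom (m ⊗ₜ s))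
    (toSheafifyMod_naturality (pre A ◁ f.val))
  exact (congrArg (φ.val.app U) h).symm

end RingedSpaces

/-! ### The algebra `B` -/

section Base

variable {V : Type u} {X : RingedSpace.{u, u}}

/-- The sections over `U` of `B = ⨁_i 𝒪_X e_i`, the direct sum being over the finite set of
vertices, with its componentwise multiplication. -/
abbrev BaseSec (V : Type u) (X : RingedSpace.{u, u}) (U : (Opens X)ᵒᵖ) : Type u := V → OSec (X := X) U

/-- Restriction of sections of `B`. -/
def baseRes {U U' : (Opens X)ᵒᵖ} (f : U ⟶ U') : BaseSec V X U →+* BaseSec V X U' :=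
  RingHom.pi fun i => (X.presheaf.map f).hom.comp (Pi.evalRingHom _ i)

open scoped Classical in
/-- The section `e_i` of `B`. -/
def baseIdem (i : V) (U : (Opens X)ᵒᵖ) : BaseSec V X U := Pi.single i 1

lemma baseRes_baseIdem (i : V) {U U' : (Opens X)ᵒᵖ} (f : U ⟶ U') :
    baseRes f (baseIdem (X := X) i U) = baseIdem i U' := by
  classical
  funext j
  change X.presheaf.map f (baseIdem i U j) = _
  by_cases h : j = i
  · subst h; simp [baseIdem]
  · simp [baseIdem, h]

end Base

/-! ### Quivers and twisted representations -/

section Quivers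

/- The finite set of arrows of the quiver is `Quiver.Total V`; the tail of an arrow `a` is `a.left`
and its head is `a.right`. -/
variable {V : Type u} [Quiver.{u} V]
variable {X : RingedSpace.{u, u}} (M : Quiver.Total V → OMod X)

/-- An `M`-twisted representation: modules `E_i` and morphisms `M_a ⊗ E_{ta} ⟶ E_{ha}`. -/
structure TwistedRep where
  /-- the modules at the vertices -/
  obj : V → OMod X
  /-- the morphisms at the arrows -/
  φ (a : Quiver.Total V) : tens (M a) (obj a.left) ⟶ obj a.right

namespace TwistedRep

variable {M}

/-- Morphisms of twisted representations. -/
@[ext]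
structure Hom (E E' : TwistedRep M) where
  /-- the components of the morphism -/
  app (i : V) : E.obj i ⟶ E'.obj i
  comm (a : Quiver.Total V) :
    E.φ a ≫ app a.right = tensMap (M a) (app a.left) ≫ E'.φ a

/-- The category `Rep(MQ)` of `M`-twisted representations. -/
instance : Category (TwistedRep M) where
  Hom := Hom
  id E := ⟨fun _ => 𝟙 _, fun a => by simp [tensMap_id]⟩
  comp f g := ⟨fun i => f.app i ≫ g.app i, fun a => by
    rw [← Category.assoc, f.comm, Category.assoc, g.comm, tensMap_comp, Category.assoc]⟩
  id_comp f := Hom.ext (funext fun _ => Category.id_comp _)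
  comp_id f := Hom.ext (funext fun _ => Category.comp_id _)
  assoc f g h := Hom.ext (funext fun _ => Category.assoc _ _ _)

@[simp] lemma id_app (E : TwistedRep M) (i : V) : Hom.app (𝟙 E) i = 𝟙 (E.obj i) := rfl

@[simp] lemma comp_app {E E' E'' : TwistedRep M} (f : E ⟶ E') (g : E' ⟶ E'') (i : V) :
    Hom.app (f ≫ g) i = Hom.app f i ≫ Hom.app g i := rfl

@[ext] lemma hom_ext {E E' : TwistedRep M} {f g : E ⟶ E'} (h : ∀ i, f.app i = g.app i) : f = g :=
  Hom.ext (funext h)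

end TwistedRep

/-! ### The twisted path algebra -/

/-- The sections over `U` of `⨁_a M_a`, the direct sum being over the finite set of arrows. -/
def ArrowSec (U : (Opens X)ᵒᵖ) : Type u := ∀ a : Quiver.Total V, Sec (M a) U

instance (U : (Opens X)ᵒᵖ) : AddCommGroup (ArrowSec M U) :=
  inferInstanceAs (AddCommGroup (∀ a : Quiver.Total V, Sec (M a) U))

/-- The left action of `B`: `e_i m = m` if `ha = i` and `e_i m = 0` otherwise, for `m` in `M_a`. -/
instance (U : (Opens X)ᵒᵖ) : Module (BaseSec V X U) (ArrowSec M U) where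
  smul b w := fun a => b a.right • w a
  one_smul w := funext fun a => one_smul _ (w a)
  mul_smul b c w := funext fun a => mul_smul (b a.right) (c a.right) (w a)
  smul_zero b := funext fun a => smul_zero (b a.right)
  smul_add b v w := funext fun a => smul_add (b a.right) (v a) (w a)
  add_smul b c w := funext fun a => add_smul (b a.right) (c a.right) (w a)
  zero_smul w := funext fun a => zero_smul _ (w a)

/-- The right action of `B`: `m e_i = m` if `ta = i` and `m e_i = 0` otherwise, for `m` in `M_a`. -/
instance (U : (Opens X)ᵒᵖ) : Module (BaseSec V X U)ᵐᵒᵖ (ArrowSec M U) where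
  smul b w := fun a => b.unop a.left • w a
  one_smul w := funext fun a => one_smul _ (w a)
  mul_smul b c w := funext fun a => by
    change (c.unop a.left * b.unop a.left) • w a = b.unop a.left • c.unop a.left • w a
    rw [mul_comm, mul_smul]
  smul_zero b := funext fun a => smul_zero (b.unop a.left)
  smul_add b v w := funext fun a => smul_add (b.unop a.left) (v a) (w a)
  add_smul b c w := funext fun a => add_smul (b.unop a.left) (c.unop a.left) (w a)
  zero_smul w := funext fun a => zero_smul _ (w a)

instance (U : (Opens X)ᵒᵖ) : SMulCommClass (BaseSec V X U) (BaseSec V X U)ᵐᵒᵖ (ArrowSec M U) where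
  smul_comm b c w := funext fun a => smul_comm (b a.right) (c.unop a.left) (w a)

/-- The ring `T_{B(U)}((⨁_a M_a)(U))`. -/
abbrev PathAlgSec (U : (Opens X)ᵒᵖ) : Type u :=
  BimoduleTensorAlgebra (BaseSec V X U) (ArrowSec M U)

/-- Restriction of sections of `⨁_a M_a`. -/
def arrowRes {U U' : (Opens X)ᵒᵖ} (f : U ⟶ U') : ArrowSec M U →+ ArrowSec M U' :=
  AddMonoidHom.mk' (fun w a => res (M a) f (w a))
    (fun v w => funext fun a => map_add (res (M a) f) (v a) (w a))

lemma arrowRes_smul {U U' : (Opens X)ᵒᵖ} (f : U ⟶ U') (b : BaseSec V X U) (w : ArrowSec M U) :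
    arrowRes M f (b • w) = baseRes f b • arrowRes M f w :=
  funext fun a => res_smul (M a) f (b a.right) (w a)

lemma arrowRes_op_smul {U U' : (Opens X)ᵒᵖ} (f : U ⟶ U') (b : BaseSec V X U)
    (w : ArrowSec M U) :
    arrowRes M f (MulOpposite.op b • w) = MulOpposite.op (baseRes f b) • arrowRes M f w :=
  funext fun a => res_smul (M a) f (b a.left) (w a)

/-- Restriction maps of the presheaf of tensor algebras. -/
def pathAlgRes {U U' : (Opens X)ᵒᵖ} (f : U ⟶ U') : PathAlgSec M U →+* PathAlgSec M U' :=
  BimoduleTensorAlgebra.lift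
    ((BimoduleTensorAlgebra.base _ _).comp (baseRes f))
    ((BimoduleTensorAlgebra.incl _ _).comp (arrowRes M f))
    (fun b w => (congrArg _ (arrowRes_smul M f b w)).trans
        (BimoduleTensorAlgebra.incl_smul (baseRes f b) (arrowRes M f w)))
    (fun b w => (congrArg _ (arrowRes_op_smul M f b w)).trans
        (BimoduleTensorAlgebra.incl_op_smul (baseRes f b) (arrowRes M f w)))

lemma pathAlgRes_base {U U' : (Opens X)ᵒᵖ} (f : U ⟶ U') (b : BaseSec V X U) :
    pathAlgRes M f (BimoduleTensorAlgebra.base _ _ b) =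
      BimoduleTensorAlgebra.base _ _ (baseRes f b) :=
  BimoduleTensorAlgebra.lift_base _ _ _ _ _

lemma pathAlgRes_incl {U U' : (Opens X)ᵒᵖ} (f : U ⟶ U') (w : ArrowSec M U) :
    pathAlgRes M f (BimoduleTensorAlgebra.incl _ _ w) =
      BimoduleTensorAlgebra.incl _ _ (arrowRes M f w) :=
  BimoduleTensorAlgebra.lift_incl _ _ _ _ _

/-- The presheaf of rings `U ↦ T_{B(U)}((⨁_a M_a)(U))`. -/
def prePathAlg : (Opens X)ᵒᵖ ⥤ RingCat.{u} where
  obj U := RingCat.of (PathAlgSec M U)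
  map f := RingCat.ofHom (pathAlgRes M f)
  map_id U := by
    apply RingCat.hom_ext
    refine BimoduleTensorAlgebra.hom_ext (fun b => ?_) (fun w => ?_)
    · refine (pathAlgRes_base M _ b).trans (congrArg _ (funext fun i => ?_))
      change X.presheaf.map (𝟙 U) (b i) = b i
      simp
    · refine (pathAlgRes_incl M _ w).trans (congrArg _ (funext fun a => ?_))
      exact res_id (M a) U (w a)
  map_comp {U U' U''} f g := by
    apply RingCat.hom_ext
    refine BimoduleTensorAlgebra.hom_ext (fun b => ?_) (fun w => ?_)
    · refine (pathAlgRes_base M _ b).trans (Eq.trans ?_ ((congrArg _ (pathAlgRes_base M f b)).trans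
        (pathAlgRes_base M g _)).symm)
      refine congrArg _ (funext fun i => ?_)
      change X.presheaf.map (f ≫ g) (b i) = X.presheaf.map g (X.presheaf.map f (b i))
      simp
    · refine (pathAlgRes_incl M _ w).trans (Eq.trans ?_ ((congrArg _ (pathAlgRes_incl M f w)).trans
        (pathAlgRes_incl M g _)).symm)
      exact congrArg _ (funext fun a => res_comp (M a) f g (w a))

/-- The `M`-twisted path algebra: the tensor algebra over `B` of `⨁_a M_a`, i.e. the sheaf
associated with `U ↦ T_{B(U)}((⨁_a M_a)(U))`. -/
def pathAlg : Sheaf (Opens.grothendieckTopology X) RingCat.{u} :=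
  (presheafToSheaf (Opens.grothendieckTopology X) RingCat.{u}).obj (prePathAlg M)

/-- The canonical map from the presheaf of tensor algebras to the path algebra. -/
def toPathAlg : prePathAlg M ⟶ (pathAlg M).obj :=
  toSheafify (Opens.grothendieckTopology X) (prePathAlg M)

instance : Presheaf.IsLocallyInjective (Opens.grothendieckTopology X) (toPathAlg M) :=
  inferInstanceAs (Presheaf.IsLocallyInjective (Opens.grothendieckTopology X)
    (toSheafify (Opens.grothendieckTopology X) (prePathAlg M)))

instance : Presheaf.IsLocallySurjective (Opens.grothendieckTopology X) (toPathAlg M) :=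
  inferInstanceAs (Presheaf.IsLocallySurjective (Opens.grothendieckTopology X)
    (toSheafify (Opens.grothendieckTopology X) (prePathAlg M)))

/-- The section over `U` of the path algebra given by `b ∈ B(U)`. -/
def ofBase (U : (Opens X)ᵒᵖ) : BaseSec V X U →+* (pathAlg M).obj.obj U :=
  ((toPathAlg M).app U).hom.comp (BimoduleTensorAlgebra.base _ _)

/-- The section over `U` of the path algebra given by `w ∈ (⨁_a M_a)(U)`. -/
def ofArrow (U : (Opens X)ᵒᵖ) : ArrowSec M U →+ (pathAlg M).obj.obj U :=
  ((toPathAlg M).app U).hom.toAddMonoidHom.comp (BimoduleTensorAlgebra.incl _ _)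

lemma ofBase_res {U U' : (Opens X)ᵒᵖ} (f : U ⟶ U') (b : BaseSec V X U) :
    (pathAlg M).obj.map f (ofBase M U b) = ofBase M U' (baseRes f b) :=
  (NatTrans.naturality_apply (toPathAlg M) f _).symm.trans
    (congrArg _ (pathAlgRes_base M f b))

lemma ofArrow_res {U U' : (Opens X)ᵒᵖ} (f : U ⟶ U') (w : ArrowSec M U) :
    (pathAlg M).obj.map f (ofArrow M U w) = ofArrow M U' (arrowRes M f w) :=
  (NatTrans.naturality_apply (toPathAlg M) f _).symm.trans
    (congrArg _ (pathAlgRes_incl M f w))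

lemma ofArrow_smul (U : (Opens X)ᵒᵖ) (b : BaseSec V X U) (w : ArrowSec M U) :
    ofArrow M U (b • w) = ofBase M U b * ofArrow M U w :=
  (congrArg ((toPathAlg M).app U).hom (BimoduleTensorAlgebra.incl_smul b w)).trans (map_mul _ _ _)

lemma ofArrow_op_smul (U : (Opens X)ᵒᵖ) (b : BaseSec V X U) (w : ArrowSec M U) :
    ofArrow M U (MulOpposite.op b • w) = ofArrow M U w * ofBase M U b :=
  (congrArg ((toPathAlg M).app U).hom
    (BimoduleTensorAlgebra.incl_op_smul b w)).trans (map_mul _ _ _)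

/-- The structure of an `𝒪_X`-algebra on the path algebra: `f ↦ ∑_i f e_i`. -/
def algMap : structureSheaf X ⟶ pathAlg M where
  hom :=
    { app U := RingCat.ofHom ((ofBase M U).comp (Pi.constRingHom V (OSec (X := X) U)))
      naturality U U' f := by
        apply RingCat.hom_ext
        refine RingHom.ext fun r => ?_
        exact (ofBase_res M f (fun _ => r)).symm }

lemma algMap_mul_ofBase (U : (Opens X)ᵒᵖ) (r : OSec U) (b : BaseSec V X U) :
    ofBase M U (fun _ => r) * ofBase M U b = ofBase M U b * ofBase M U (fun _ => r) := by
  rw [← map_mul, ← map_mul, mul_comm]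

lemma algMap_mul_ofArrow (U : (Opens X)ᵒᵖ) (r : OSec U) (w : ArrowSec M U) :
    ofBase M U (fun _ => r) * ofArrow M U w = ofArrow M U w * ofBase M U (fun _ => r) := by
  rw [← ofArrow_smul, ← ofArrow_op_smul]; rfl

/-! ### The functor from representations to modules over the path algebra -/

/-- The sections over `U` of `⨁_i E_i`, the direct sum being over the finite set of vertices. -/
def RepSec {M : Quiver.Total V → OMod X} (E : TwistedRep M) (U : (Opens X)ᵒᵖ) : Type u :=
  ∀ i : V, Sec (E.obj i) U

section FunctorG

variable {M} (E : TwistedRep M)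

instance (U : (Opens X)ᵒᵖ) : AddCommGroup (RepSec E U) :=
  inferInstanceAs (AddCommGroup (∀ i : V, Sec (E.obj i) U))

/-- The action of `B` on `⨁_i E_i`, in which `e_i` is the projection to `E_i`. -/
def baseAct (U : (Opens X)ᵒᵖ) : BaseSec V X U →+* AddMonoid.End (RepSec E U) where
  toFun b := AddMonoidHom.mk' (fun s i => b i • s i)
    (fun s t => funext fun i => smul_add (b i) (s i) (t i))
  map_one' := AddMonoidHom.ext fun s => funext fun i => one_smul _ (s i)
  map_mul' b c := AddMonoidHom.ext fun s => funext fun i => mul_smul (b i) (c i) (s i)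
  map_zero' := AddMonoidHom.ext fun s => funext fun i => zero_smul _ (s i)
  map_add' b c := AddMonoidHom.ext fun s => funext fun i => add_smul (b i) (c i) (s i)

open scoped Classical in
/-- The inclusion of a summand. -/
def repSingle (U : (Opens X)ᵒᵖ) (i : V) : Sec (E.obj i) U →+ RepSec E U :=
  AddMonoidHom.single (fun i => Sec (E.obj i) U) i

open scoped Classical in
lemma repSingle_apply (U : (Opens X)ᵒᵖ) (i : V) (s : Sec (E.obj i) U) (j : V) :
    repSingle E U i s j = if h : i = j then h ▸ s else 0 := by
  by_cases h : i = j
  · subst h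
    rw [dif_pos rfl]
    exact Pi.single_eq_same (M := fun i => Sec (E.obj i) U) i s
  · rw [dif_neg h]
    exact Pi.single_eq_of_ne (M := fun i => Sec (E.obj i) U) (Ne.symm h) s

lemma baseAct_repSingle (U : (Opens X)ᵒᵖ) (b : BaseSec V X U) (i : V) (s : Sec (E.obj i) U) :
    baseAct E U b (repSingle E U i s) = repSingle E U i (b i • s) := by
  funext j
  change b j • repSingle E U i s j = _
  rw [repSingle_apply, repSingle_apply]
  by_cases h : i = j
  · subst h; simp
  · simp [h]

/-- Restriction of sections of `⨁_i E_i`. -/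
def repRes {U U' : (Opens X)ᵒᵖ} (f : U ⟶ U') : RepSec E U →+ RepSec E U' :=
  AddMonoidHom.mk' (fun s i => res (E.obj i) f (s i))
    (fun s t => funext fun i => map_add (res (E.obj i) f) (s i) (t i))

lemma repRes_repSingle {U U' : (Opens X)ᵒᵖ} (f : U ⟶ U') (i : V) (s : Sec (E.obj i) U) :
    repRes E f (repSingle E U i s) = repSingle E U' i (res (E.obj i) f s) := by
  funext j
  change res (E.obj j) f (repSingle E U i s j) = _
  rw [repSingle_apply, repSingle_apply]
  by_cases h : i = j
  · subst h; simp
  · simp [h]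

/-- The action of a morphism of representations on `⨁_i E_i`. -/
def repMap {E E' : TwistedRep M} (f : E ⟶ E') (U : (Opens X)ᵒᵖ) : RepSec E U →+ RepSec E' U :=
  AddMonoidHom.mk' (fun s i => onSec (f.app i) U (s i))
    (fun s t => funext fun i => map_add (onSec (f.app i) U) (s i) (t i))

lemma repMap_repSingle {E E' : TwistedRep M} (f : E ⟶ E') (U : (Opens X)ᵒᵖ) (i : V)
    (s : Sec (E.obj i) U) :
    repMap f U (repSingle E U i s) = repSingle E' U i (onSec (f.app i) U s) := by
  funext j
  change onSec (f.app j) U (repSingle E U i s j) = _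
  rw [repSingle_apply, repSingle_apply]
  by_cases h : i = j
  · subst h; simp
  · simp [h]

variable [Fintype (Quiver.Total V)]

/-- The action of `⨁_a M_a` on `⨁_i E_i`: a section `m` of `M_a` sends `s` to
`φ_a(m ⊗ s_{ta})` in `E_{ha}`. -/
def arrowAct (U : (Opens X)ᵒᵖ) : ArrowSec M U →+ AddMonoid.End (RepSec E U) :=
  AddMonoidHom.mk' (fun w => AddMonoidHom.mk'
      (fun s => ∑ a : Quiver.Total V,
        repSingle E U a.right (pairing (E.φ a) U (w a) (s a.left)))
      (fun s t => by
        rw [← Finset.sum_add_distrib]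
        refine Finset.sum_congr rfl fun a _ => ?_
        rw [← map_add, ← map_add]; rfl))
    (fun v w => AddMonoidHom.ext fun s => by
      refine Eq.trans ?_ Finset.sum_add_distrib
      refine Finset.sum_congr rfl fun a _ => ?_
      rw [← map_add, ← LinearMap.add_apply, ← map_add]; rfl)

lemma arrowAct_apply (U : (Opens X)ᵒᵖ) (w : ArrowSec M U) (s : RepSec E U) :
    arrowAct E U w s = ∑ a : Quiver.Total V,
        repSingle E U a.right (pairing (E.φ a) U (w a) (s a.left)) := rfl

/-- The action of the presheaf of tensor algebras on `⨁_i E_i`. -/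
def pathAlgAct (U : (Opens X)ᵒᵖ) : PathAlgSec M U →+* AddMonoid.End (RepSec E U) :=
  BimoduleTensorAlgebra.lift (baseAct E U) (arrowAct E U)
    (fun b w => AddMonoidHom.ext fun s => by
      refine Eq.trans ?_ (map_sum (baseAct E U b) _ _).symm
      refine Finset.sum_congr rfl fun a _ => ?_
      refine Eq.trans ?_ (baseAct_repSingle E U b _ _).symm
      rw [← LinearMap.smul_apply, ← map_smul]; rfl)
    (fun b w => AddMonoidHom.ext fun s => by
      refine Finset.sum_congr rfl fun a _ => congrArg _ ?_
      change pairing (E.φ a) U (b a.left • w a) (s a.left) =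
        pairing (E.φ a) U (w a) (b a.left • s a.left)
      rw [map_smul, map_smul, LinearMap.smul_apply])

instance (U : (Opens X)ᵒᵖ) : Module (PathAlgSec M U) (RepSec E U) :=
  Module.compHom _ (pathAlgAct E U)

lemma base_smul (U : (Opens X)ᵒᵖ) (b : BaseSec V X U) (s : RepSec E U) :
    (BimoduleTensorAlgebra.base _ _ b : PathAlgSec M U) • s = fun i => b i • s i :=
  congrArg (fun f : AddMonoid.End (RepSec E U) => f s)
    (BimoduleTensorAlgebra.lift_base (baseAct E U) (arrowAct E U) _ _ b)

lemma incl_smul (U : (Opens X)ᵒᵖ) (w : ArrowSec M U) (s : RepSec E U) :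
    (BimoduleTensorAlgebra.incl _ _ w : PathAlgSec M U) • s = ∑ a : Quiver.Total V,
        repSingle E U a.right (pairing (E.φ a) U (w a) (s a.left)) :=
  congrArg (fun f : AddMonoid.End (RepSec E U) => f s)
    (BimoduleTensorAlgebra.lift_incl (baseAct E U) (arrowAct E U) _ _ w)

/-- An additive map commuting with the actions of `B` and of `⨁_a M_a` commutes with the action
of the tensor algebra. -/
lemma semilinear_of_generators {U U' : (Opens X)ᵒᵖ} {E' : TwistedRep M}
    (σ : PathAlgSec M U →+* PathAlgSec M U') (g : RepSec E U →+ RepSec E' U')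
    (hb : ∀ (b : BaseSec V X U) (s : RepSec E U),
      g ((BimoduleTensorAlgebra.base _ _ b : PathAlgSec M U) • s) =
        σ (BimoduleTensorAlgebra.base _ _ b) • g s)
    (hw : ∀ (w : ArrowSec M U) (s : RepSec E U),
      g ((BimoduleTensorAlgebra.incl _ _ w : PathAlgSec M U) • s) =
        σ (BimoduleTensorAlgebra.incl _ _ w) • g s)
    (r : PathAlgSec M U) (s : RepSec E U) : g (r • s) = σ r • g s := by
  obtain ⟨x, rfl⟩ := RingQuot.mkRingHom_surjective _ r
  induction x using FreeAlgebra.induction generalizing s with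
  | grade0 n =>
    have h : algebraMap ℤ (FreeAlgebra ℤ (BaseSec V X U ⊕ ArrowSec M U)) n = n := by simp
    rw [h, map_intCast]
    change g ((n : PathAlgSec M U) • s) = σ (n : PathAlgSec M U) • g s
    rw [map_intCast, Int.cast_smul_eq_zsmul, Int.cast_smul_eq_zsmul, map_zsmul]
  | grade1 x =>
    cases x with
    | inl b => exact hb b s
    | inr w => exact hw w s
  | mul a b ha hb' =>
    rw [map_mul]
    exact (congrArg g (mul_smul _ _ s)).trans ((ha _).trans ((congrArg _ (hb' s)).trans
      ((mul_smul _ _ _).symm.trans (congrArg (· • g s) (map_mul σ _ _).symm))))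
  | add a b ha hb' =>
    rw [map_add]
    exact (congrArg g (add_smul _ _ s)).trans ((map_add g _ _).trans
      ((congrArg₂ (· + ·) (ha s) (hb' s)).trans
        ((add_smul _ _ _).symm.trans (congrArg (· • g s) (map_add σ _ _).symm))))

lemma repRes_smul {U U' : (Opens X)ᵒᵖ} (f : U ⟶ U') (r : PathAlgSec M U) (s : RepSec E U) :
    repRes E f (r • s) = pathAlgRes M f r • repRes E f s := by
  refine semilinear_of_generators E (pathAlgRes M f) (repRes E f) (fun b s => ?_)
    (fun w s => ?_) r s
  · rw [pathAlgRes_base, base_smul, base_smul]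
    exact funext fun i => res_smul (E.obj i) f (b i) (s i)
  · rw [pathAlgRes_incl, incl_smul, incl_smul, map_sum]
    refine Finset.sum_congr rfl fun a _ => ?_
    rw [repRes_repSingle, pairing_res]
    rfl

/-- The presheaf of abelian groups `⨁_i E_i`. -/
def repAb : (Opens X)ᵒᵖ ⥤ Ab.{u} where
  obj U := AddCommGrpCat.of (RepSec E U)
  map f := AddCommGrpCat.ofHom (repRes E f)
  map_id U := by
    ext s
    refine funext fun i => ?_
    exact res_id (E.obj i) U (s i)
  map_comp f g := by
    ext s
    exact funext fun i => res_comp (E.obj i) f g (s i)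

instance (U : (Opens X)ᵒᵖ) : Module ((prePathAlg M).obj U) ((repAb E).obj U) :=
  inferInstanceAs (Module (PathAlgSec M U) (RepSec E U))

/-- The direct sum `⨁_i E_i` as a module over the presheaf of tensor algebras. -/
def preG : PresheafOfModules.{u} (prePathAlg M) :=
  PresheafOfModules.ofPresheaf (repAb E) (fun _ _ f r s => repRes_smul E f r s)

lemma repMap_smul {E E' : TwistedRep M} (f : E ⟶ E') (U : (Opens X)ᵒᵖ)
    (r : PathAlgSec M U) (s : RepSec E U) : repMap f U (r • s) = r • repMap f U s := by
  refine semilinear_of_generators E (RingHom.id _) (repMap f U) (fun b s => ?_)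
    (fun w s => ?_) r s
  · rw [RingHom.id_apply, base_smul, base_smul]
    exact funext fun i => map_smul (onSec (f.app i) U) (b i) (s i)
  · rw [RingHom.id_apply, incl_smul, incl_smul, map_sum]
    refine Finset.sum_congr rfl fun a _ => ?_
    rw [repMap_repSingle, ← pairing_comp, f.comm, pairing_tensMap_comp]
    rfl

variable (M)

/-- The functor `E ↦ ⨁_i E_i` to modules over the presheaf of tensor algebras. -/
def preGFunctor : TwistedRep M ⥤ PresheafOfModules.{u} (prePathAlg M) where
  obj E := preG E
  map {E E'} f := PresheafOfModules.homMk
    { app U := AddCommGrpCat.ofHom (repMap f U)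
      naturality U U' g := by
        ext s
        exact funext fun i => onSec_res (f.app i) g (s i) }
    (fun U r s => repMap_smul f U r s)
  map_id E := rfl
  map_comp f g := rfl

/-- The functor `G : Rep(MQ) ⥤ T_M A_Q-mod`. It sends `E` to `⨁_i E_i`, on which `e_i` acts as
the projection to `E_i` and a section `m` of `M_a` acts by `s ↦ φ_a(m ⊗ s_{ta}) ∈ E_{ha}`.
(Sheafification does not change the sections of `⨁_i E_i`; it extends the action of the presheaf
of tensor algebras to its associated sheaf.) -/
def functorG : TwistedRep M ⥤ SheafOfModules.{u} (pathAlg M) :=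
  preGFunctor M ⋙ PresheafOfModules.sheafification (toPathAlg M)

variable {M}

/-- The inclusion of the summand `E_i` into `G(E)`, on sections. -/
def inclG (i : V) (U : (Opens X)ᵒᵖ) (s : Sec (E.obj i) U) : ((functorG M).obj E).val.obj U :=
  ((PresheafOfModules.sheafificationAdjunction (toPathAlg M)).unit.app (preG E)).app U
    (show (preG E).obj U from repSingle E U i s)

end FunctorG

/-! ### The functor from modules over the path algebra to representations -/

section FunctorF

/-- The `𝒪_X`-module underlying a module over the path algebra. -/
abbrev toOMod : SheafOfModules.{u} (pathAlg M) ⥤ OMod X :=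
  SheafOfModules.restrictScalars (algMap M)

open scoped Classical in
/-- The inclusion of the summand `M_a` in `⨁_a M_a`. -/
def arrowSingle (a : Quiver.Total V) (U : (Opens X)ᵒᵖ) : Sec (M a) U →+ ArrowSec M U :=
  AddMonoidHom.single (fun a => Sec (M a) U) a

open scoped Classical in
lemma arrowSingle_apply (a : Quiver.Total V) (U : (Opens X)ᵒᵖ) (m : Sec (M a) U)
    (b : Quiver.Total V) : arrowSingle M a U m b = if h : a = b then h ▸ m else 0 := by
  by_cases h : a = b
  · subst h
    rw [dif_pos rfl]
    exact Pi.single_eq_same (M := fun a => Sec (M a) U) a m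
  · rw [dif_neg h]
    exact Pi.single_eq_of_ne (M := fun a => Sec (M a) U) (Ne.symm h) m

lemma arrowSingle_smul (a : Quiver.Total V) (U : (Opens X)ᵒᵖ) (r : OSec U) (m : Sec (M a) U) :
    arrowSingle M a U (r • m) = (fun _ => r : BaseSec V X U) • arrowSingle M a U m := by
  funext b
  change _ = r • arrowSingle M a U m b
  rw [arrowSingle_apply, arrowSingle_apply]
  by_cases h : a = b
  · subst h; simp
  · simp [h]

lemma arrowRes_arrowSingle (a : Quiver.Total V) {U U' : (Opens X)ᵒᵖ} (f : U ⟶ U')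
    (m : Sec (M a) U) :
    arrowRes M f (arrowSingle M a U m) = arrowSingle M a U' (res (M a) f m) := by
  funext b
  change res (M b) f (arrowSingle M a U m b) = _
  rw [arrowSingle_apply, arrowSingle_apply]
  by_cases h : a = b
  · subst h; simp
  · simp [h]

/-- The section `m` of the summand `M_a` of the path algebra. -/
def ofArrowSingle (a : Quiver.Total V) (U : (Opens X)ᵒᵖ) :
    Sec (M a) U →+ (pathAlg M).obj.obj U :=
  (ofArrow M U).comp (arrowSingle M a U)

lemma ofArrowSingle_res (a : Quiver.Total V) {U U' : (Opens X)ᵒᵖ} (f : U ⟶ U')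
    (m : Sec (M a) U) :
    (pathAlg M).obj.map f (ofArrowSingle M a U m) = ofArrowSingle M a U' (res (M a) f m) :=
  (ofArrow_res M f _).trans (congrArg _ (arrowRes_arrowSingle M a f m))

variable (N : SheafOfModules.{u} (pathAlg M))

/-- The action of the sections of the path algebra on the sections of `N`. -/
def secEnd (U : (Opens X)ᵒᵖ) :
    (pathAlg M).obj.obj U →+* AddMonoid.End (Sec ((toOMod M).obj N) U) :=
  Module.toAddMonoidEnd ((pathAlg M).obj.obj U) (N.val.obj U)

lemma secEnd_mul (U : (Opens X)ᵒᵖ) (t t' : (pathAlg M).obj.obj U)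
    (s : Sec ((toOMod M).obj N) U) :
    secEnd M N U (t * t') s = secEnd M N U t (secEnd M N U t' s) :=
  congrArg (fun f : AddMonoid.End _ => f s) (map_mul (secEnd M N U) t t')

lemma secEnd_add_left (U : (Opens X)ᵒᵖ) (t t' : (pathAlg M).obj.obj U)
    (s : Sec ((toOMod M).obj N) U) :
    secEnd M N U (t + t') s = secEnd M N U t s + secEnd M N U t' s :=
  congrArg (fun f : AddMonoid.End _ => f s) (map_add (secEnd M N U) t t')

lemma secEnd_add_right (U : (Opens X)ᵒᵖ) (t : (pathAlg M).obj.obj U)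
    (s s' : Sec ((toOMod M).obj N) U) :
    secEnd M N U t (s + s') = secEnd M N U t s + secEnd M N U t s' :=
  smul_add (A := N.val.obj U) t s s'

lemma toOMod_smul (U : (Opens X)ᵒᵖ) (r : OSec U) (s : Sec ((toOMod M).obj N) U) :
    r • s = secEnd M N U (ofBase M U (fun _ => r)) s := rfl

lemma secEnd_res {U U' : (Opens X)ᵒᵖ} (f : U ⟶ U') (t : (pathAlg M).obj.obj U)
    (s : Sec ((toOMod M).obj N) U) :
    res ((toOMod M).obj N) f (secEnd M N U t s) =
      secEnd M N U' ((pathAlg M).obj.map f t) (res ((toOMod M).obj N) f s) :=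
  N.val.map_smul f t s

lemma secEnd_naturality {N N' : SheafOfModules.{u} (pathAlg M)} (g : N ⟶ N')
    (U : (Opens X)ᵒᵖ) (t : (pathAlg M).obj.obj U) (s : Sec ((toOMod M).obj N) U) :
    onSec ((toOMod M).map g) U (secEnd M N U t s) =
      secEnd M N' U t (onSec ((toOMod M).map g) U s) :=
  (g.val.app U).hom.map_smul t s

/-- The action `M_a(U) × N(U) → N(U)`. -/
def actSec (a : Quiver.Total V) (U : (Opens X)ᵒᵖ) :
    Sec (M a) U →ₗ[OSec U] Sec ((toOMod M).obj N) U →ₗ[OSec U] Sec ((toOMod M).obj N) U :=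
  LinearMap.mk₂ (OSec U) (fun m s => secEnd M N U (ofArrowSingle M a U m) s)
    (fun m m' s => by rw [map_add, secEnd_add_left])
    (fun r m s => by
      rw [toOMod_smul, ← secEnd_mul, ofArrowSingle, AddMonoidHom.comp_apply, arrowSingle_smul,
        ofArrow_smul]; rfl)
    (fun m s s' => secEnd_add_right M N U _ s s')
    (fun r m s => by
      rw [toOMod_smul, toOMod_smul, ← secEnd_mul, ← secEnd_mul, ofArrowSingle,
        AddMonoidHom.comp_apply, algMap_mul_ofArrow])

/-- The action `M_a ⊗ N ⟶ N`, `m ⊗ s ↦ m s`, on presheaves. -/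
def preAct (a : Quiver.Total V) :
    pre (M a) ⊗ pre ((toOMod M).obj N) ⟶ pre ((toOMod M).obj N) where
  app U := ModuleCat.ofHom (R := OSec U)
    (X := TensorProduct (OSec U) (Sec (M a) U) (Sec ((toOMod M).obj N) U))
    (Y := Sec ((toOMod M).obj N) U) (TensorProduct.lift (actSec M N a U))
  naturality {U U'} f := ModuleCat.MonoidalCategory.tensor_ext (fun m s => by
    change actSec M N a U' (res (M a) f m) (res ((toOMod M).obj N) f s) =
      res ((toOMod M).obj N) f (actSec M N a U m s)
    exact ((secEnd_res M N f _ s).trans (congrArg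
      (fun t => secEnd M N U' t (res ((toOMod M).obj N) f s)) (ofArrowSingle_res M a f m))).symm)

lemma preAct_naturality (a : Quiver.Total V) {N N' : SheafOfModules.{u} (pathAlg M)}
    (g : N ⟶ N') :
    preAct M N a ≫ ((toOMod M).map g).val =
      (pre (M a) ◁ ((toOMod M).map g).val) ≫ preAct M N' a := by
  refine PresheafOfModules.hom_ext fun U => ModuleCat.MonoidalCategory.tensor_ext (fun m s => ?_)
  exact secEnd_naturality M g U (ofArrowSingle M a U m) s

/-- The action `M_a ⊗ N ⟶ N`. -/
def act (a : Quiver.Total V) : tens (M a) ((toOMod M).obj N) ⟶ (toOMod M).obj N :=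
  sheafifyModLift (preAct M N a)

lemma act_naturality (a : Quiver.Total V) {N N' : SheafOfModules.{u} (pathAlg M)}
    (g : N ⟶ N') :
    act M N a ≫ (toOMod M).map g = tensMap (M a) ((toOMod M).map g) ≫ act M N' a := by
  exact (sheafifyModLift_naturality_right _ _).symm.trans
    ((congrArg sheafifyModLift (preAct_naturality M a g)).trans
      (sheafifyModLift_naturality_left _ _))

/-- Multiplication by `e_i`, as an endomorphism of the `𝒪_X`-module `N`. -/
def idem (i : V) : (toOMod M).obj N ⟶ (toOMod M).obj N where
  val :=
    { app U := ModuleCat.ofHom (R := OSec U)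
        (X := Sec ((toOMod M).obj N) U) (Y := Sec ((toOMod M).obj N) U)
        { toFun := fun s => secEnd M N U (ofBase M U (baseIdem i U)) s
          map_add' := fun s s' => secEnd_add_right M N U _ s s'
          map_smul' := fun r s => by
            change secEnd M N U _ (secEnd M N U (ofBase M U (fun _ => r)) s) =
              secEnd M N U (ofBase M U (fun _ => r)) (secEnd M N U _ s)
            rw [← secEnd_mul, ← secEnd_mul, algMap_mul_ofBase] }
      naturality {U U'} f := by
        ext s
        exact ((secEnd_res M N f _ s).trans (congrArg
          (fun t => secEnd M N U' t (res ((toOMod M).obj N) f s))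
          ((ofBase_res M f _).trans (congrArg _ (baseRes_baseIdem i f))))).symm }

lemma idem_naturality (i : V) {N N' : SheafOfModules.{u} (pathAlg M)} (g : N ⟶ N') :
    (toOMod M).map g ≫ idem M N' i = idem M N i ≫ (toOMod M).map g := by
  refine SheafOfModules.hom_ext (PresheafOfModules.hom_ext fun U => ?_)
  ext s
  exact (secEnd_naturality M g U (ofBase M U (baseIdem i U)) s).symm

/-- The representation `F(N)`, with `F(N)_i = e_i N` and with `M_a ⊗ e_{ta} N ⟶ e_{ha} N`
induced by the action. (For `m` in `M_a` and `s` in `e_{ta} N` one has `m s = e_{ha} m s`, so that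
the last morphism does not change `m s`.) -/
def objF : TwistedRep M where
  obj i := image (idem M N i)
  φ a := tensMap (M a) (image.ι (idem M N a.left)) ≫ act M N a ≫
    factorThruImage (idem M N a.right)

variable {N}

/-- The restriction `e_i N ⟶ e_i N'` of a morphism `N ⟶ N'`. -/
def mapF {N' : SheafOfModules.{u} (pathAlg M)} (g : N ⟶ N') (i : V) :
    image (idem M N i) ⟶ image (idem M N' i) :=
  image.map (Arrow.homMk ((toOMod M).map g) ((toOMod M).map g) (idem_naturality M i g) :
    Arrow.mk (idem M N i) ⟶ Arrow.mk (idem M N' i))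

lemma mapF_ι {N' : SheafOfModules.{u} (pathAlg M)} (g : N ⟶ N') (i : V) :
    mapF M g i ≫ image.ι (idem M N' i) = image.ι (idem M N i) ≫ (toOMod M).map g :=
  image.map_ι _

lemma factor_mapF {N' : SheafOfModules.{u} (pathAlg M)} (g : N ⟶ N') (i : V) :
    factorThruImage (idem M N i) ≫ mapF M g i =
      (toOMod M).map g ≫ factorThruImage (idem M N' i) :=
  image.factor_map (Arrow.homMk ((toOMod M).map g) ((toOMod M).map g) (idem_naturality M i g) :
    Arrow.mk (idem M N i) ⟶ Arrow.mk (idem M N' i))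

/-- The functor `F : T_M A_Q-mod ⥤ Rep(MQ)`. -/
def functorF : SheafOfModules.{u} (pathAlg M) ⥤ TwistedRep M where
  obj N := objF M N
  map {N N'} g :=
    { app := mapF M g
      comm a := by
        change (tensMap (M a) (image.ι (idem M N a.left)) ≫ act M N a ≫
          factorThruImage (idem M N a.right)) ≫ mapF M g a.right =
          tensMap (M a) (mapF M g a.left) ≫ tensMap (M a) (image.ι (idem M N' a.left)) ≫
            act M N' a ≫ factorThruImage (idem M N' a.right)
        rw [Category.assoc, Category.assoc, factor_mapF, ← Category.assoc (act M N a),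
          act_naturality, ← Category.assoc (tensMap (M a) (mapF M g a.left)), ← tensMap_comp,
          mapF_ι, tensMap_comp]
        simp only [Category.assoc] }
  map_id N := TwistedRep.hom_ext fun i => by
    apply (cancel_mono (image.ι (idem M N i))).mp
    refine (mapF_ι M (𝟙 N) i).trans ?_
    rw [(toOMod M).map_id, Category.comp_id]
    exact (Category.id_comp _).symm
  map_comp {N N' N''} g h := TwistedRep.hom_ext fun i => by
    apply (cancel_mono (image.ι (idem M N'' i))).mp
    refine (mapF_ι M (g ≫ h) i).trans ?_
    change _ = (mapF M g i ≫ mapF M h i) ≫ _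
    rw [Category.assoc, mapF_ι, ← Category.assoc, mapF_ι, Category.assoc, Functor.map_comp]

end FunctorF

/-! ### Relations -/

section Relations

/-- The presheaf tensor product `M_{a_1} ⊗ ⋯ ⊗ M_{a_k}` along a path `a_1 ⋯ a_k` (`a_k` being the
first arrow and `a_1` the last one), the trivial paths giving `𝒪_X`. -/
def prePathMod {i : V} : ∀ {j : V}, Quiver.Path i j → OPreMod X
  | _, .nil => 𝟙_ (OPreMod X)
  | _, .cons p e => pre (M ⟨_, _, e⟩) ⊗ prePathMod p

/-- The `𝒪_X`-module `M_p = M_{a_1} ⊗ ⋯ ⊗ M_{a_k}` of a path `p = a_1 ⋯ a_k`. -/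
def pathMod {i j : V} (p : Quiver.Path i j) : OMod X := sheafifyMod.obj (prePathMod M p)

/-- The path algebra as an `𝒪_X`-module. -/
abbrev pathAlgMod : OMod X := (toOMod M).obj (SheafOfModules.unit (pathAlg M))

/-- The map `f ↦ f e_i` from `𝒪_X` to the path algebra. -/
def vertexIncl (i : V) : 𝟙_ (OPreMod X) ⟶ pre (pathAlgMod M) :=
  (pre (pathAlgMod M)).unitHomEquiv.symm
    (PresheafOfModules.sectionsMk (fun U => ofBase M U (baseIdem i U)) (fun _ _ f =>
      (ofBase_res M f _).trans (congrArg _ (baseRes_baseIdem i f))))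

/-- The map `m_1 ⊗ ⋯ ⊗ m_k ↦ m_1 ⋯ m_k` to the path algebra. -/
def prePathIncl {i : V} : ∀ {j : V} (p : Quiver.Path i j),
    prePathMod M p ⟶ pre (pathAlgMod M)
  | _, .nil => vertexIncl M i
  | _, .cons p e => (pre (M ⟨_, _, e⟩) ◁ prePathIncl p) ≫ preAct M _ ⟨_, _, e⟩

/-- The canonical map `M_p ⟶ T_M A_Q`. -/
def pathIncl {i j : V} (p : Quiver.Path i j) : pathMod M p ⟶ pathAlgMod M :=
  sheafifyModLift (prePathIncl M p)

/-- A relation: a finite sum of global sections `m_p ∈ M_p(X)`, over the paths `p` of length at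
least `2` with a given tail `src` and a given head `tgt`. -/
structure Relation where
  /-- the tail of the paths in the relation -/
  src : V
  /-- the head of the paths in the relation -/
  tgt : V
  /-- the summands `m_p` -/
  coeff : Π₀ p : {p : Quiver.Path src tgt // 2 ≤ p.length}, Sec (pathMod M p.1) (op ⊤)

variable {M}

variable (M) in
/-- The map `M_p ⟶ T_M A_Q` on sections. -/
def pathSec {i j : V} (p : Quiver.Path i j) (U : (Opens X)ᵒᵖ) :
    Sec (pathMod M p) U →+ (pathAlg M).obj.obj U :=
  AddMonoidHom.mk' (fun m => onSec (pathIncl M p) U m) (map_add (onSec (pathIncl M p) U))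

open scoped Classical in
/-- The global section `∑ m_p` of the path algebra given by a relation. -/
def Relation.toSection (r : Relation M) : (pathAlg M).obj.obj (op ⊤) :=
  DFinsupp.sumAddHom (fun p : {p : Quiver.Path r.src r.tgt // 2 ≤ p.length} =>
    pathSec M p.1 (op ⊤)) r.coeff

/-- A representation `E` satisfies the relations in `R` if, for all `r = ∑ m_p` in `R`, with paths
from `i` to `j`, the morphism `∑ ψ_{m_p} : E_i ⟶ E_j` vanishes, where `ψ_{m_p}` is given by the
action of `m_p` on `G(E) = ⨁_i E_i`. -/
def Satisfies [Fintype (Quiver.Total V)] (R : Set (Relation M)) : ObjectProperty (TwistedRep M) :=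
  fun E => ∀ r ∈ R, ∀ (U : (Opens X)ᵒᵖ) (s : Sec (E.obj r.src) U),
    ((pathAlg M).obj.map (homOfLE le_top : U.unop ⟶ ⊤).op r.toSection) • inclG E r.src U s = 0

/-- The category `Rep(MQ, R)` of representations satisfying the relations in `R`. -/
abbrev RepWithRelations [Fintype (Quiver.Total V)] (R : Set (Relation M)) :=
  (Satisfies R).FullSubcategory

end Relations

end Quivers

/-! ### Quotients by ideals generated by global sections -/

section Ideals

variable {X : RingedSpace.{u, u}} (T : Sheaf (Opens.grothendieckTopology X) RingCat.{u})
  (S : Set (T.obj.obj (op ⊤)))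

/-- The two-sided ideal of `T(U)` generated by the restrictions of the sections in `S`. -/
def preIdeal (U : (Opens X)ᵒᵖ) : TwoSidedIdeal (T.obj.obj U) :=
  TwoSidedIdeal.span ((T.obj.map (homOfLE le_top : U.unop ⟶ ⊤).op).hom '' S)

lemma preIdeal_res {U U' : (Opens X)ᵒᵖ} (f : U ⟶ U') {t : T.obj.obj U}
    (ht : t ∈ preIdeal T S U) : T.obj.map f t ∈ preIdeal T S U' := by
  have h : preIdeal T S U ≤ (preIdeal T S U').comap (T.obj.map f).hom := by
    refine TwoSidedIdeal.span_le.mpr ?_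
    rintro _ ⟨r, hr, rfl⟩
    refine (TwoSidedIdeal.mem_comap _).mpr (TwoSidedIdeal.subset_span ⟨r, hr, ?_⟩)
    rw [← RingCat.comp_apply, ← T.obj.map_comp]
    rfl
  exact (TwoSidedIdeal.mem_comap _).mp (h ht)

/-- Local membership in the ideals generated by `S`. -/
def LocallyInIdeal (U : (Opens X)ᵒᵖ) (t : T.obj.obj U) : Prop :=
  ∀ x ∈ U.unop, ∃ (W : Opens X) (i : W ⟶ U.unop), x ∈ W ∧ T.obj.map i.op t ∈ preIdeal T S (op W)

/-- The two-sided ideal sheaf of `T` generated by a set `S` of global sections: the sheaf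
associated with the presheaf of two-sided ideals generated by the restrictions of `S`. -/
def idealSheaf (U : (Opens X)ᵒᵖ) : TwoSidedIdeal (T.obj.obj U) :=
  TwoSidedIdeal.mk' {t | LocallyInIdeal T S U t}
    (fun x hx => ⟨U.unop, 𝟙 _, hx, by rw [map_zero]; exact TwoSidedIdeal.zero_mem _⟩)
    (fun {s t} hs ht x hx => by
      obtain ⟨W, i, hW, h⟩ := hs x hx
      obtain ⟨W', i', hW', h'⟩ := ht x hx
      refine ⟨W ⊓ W', Opens.infLELeft W W' ≫ i, ⟨hW, hW'⟩, ?_⟩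
      rw [map_add]
      refine TwoSidedIdeal.add_mem _ ?_ ?_
      · have := preIdeal_res T S (Opens.infLELeft W W').op h
        rwa [← RingCat.comp_apply, ← T.obj.map_comp] at this
      · have := preIdeal_res T S (Opens.infLERight W W').op h'
        rwa [← RingCat.comp_apply, ← T.obj.map_comp] at this)
    (fun {t} ht x hx => by
      obtain ⟨W, i, hW, h⟩ := ht x hx
      exact ⟨W, i, hW, by rw [map_neg]; exact TwoSidedIdeal.neg_mem _ h⟩)
    (fun {s t} ht x hx => by
      obtain ⟨W, i, hW, h⟩ := ht x hx
      exact ⟨W, i, hW, by rw [map_mul]; exact TwoSidedIdeal.mul_mem_left _ _ _ h⟩)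
    (fun {s t} ht x hx => by
      obtain ⟨W, i, hW, h⟩ := ht x hx
      exact ⟨W, i, hW, by rw [map_mul]; exact TwoSidedIdeal.mul_mem_right _ _ _ h⟩)

lemma mem_idealSheaf (U : (Opens X)ᵒᵖ) (t : T.obj.obj U) :
    t ∈ idealSheaf T S U ↔ LocallyInIdeal T S U t :=
  TwoSidedIdeal.mem_mk' _ _ _ _ _ _ t

lemma idealSheaf_res {U U' : (Opens X)ᵒᵖ} (f : U ⟶ U') {t : T.obj.obj U}
    (ht : t ∈ idealSheaf T S U) : T.obj.map f t ∈ idealSheaf T S U' := by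
  rw [mem_idealSheaf] at ht ⊢
  intro x hx
  obtain ⟨W, i, hW, h⟩ := ht x (f.unop.le hx)
  refine ⟨W ⊓ U'.unop, Opens.infLERight W U'.unop, ⟨hW, hx⟩, ?_⟩
  have := preIdeal_res T S (Opens.infLELeft W U'.unop).op h
  rw [← RingCat.comp_apply, ← T.obj.map_comp] at this ⊢
  exact this

/-- Restriction maps of the quotients `T(U) / I(U)`. -/
def quotRes {U U' : (Opens X)ᵒᵖ} (f : U ⟶ U') :
    (idealSheaf T S U).ringCon.Quotient →+* (idealSheaf T S U').ringCon.Quotient :=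
  RingCon.lift _ ((RingCon.mk' (idealSheaf T S U').ringCon).comp (T.obj.map f).hom) (by
    intro a b h
    have h1 := idealSheaf_res T S f ((TwoSidedIdeal.rel_iff _ a b).mp h)
    rw [map_sub] at h1
    exact (RingCon.eq _).mpr ((TwoSidedIdeal.rel_iff _ _ _).mpr h1))

/-- The presheaf of rings `U ↦ T(U) / I(U)`. -/
def preQuot : (Opens X)ᵒᵖ ⥤ RingCat.{u} where
  obj U := RingCat.of (idealSheaf T S U).ringCon.Quotient
  map f := RingCat.ofHom (quotRes T S f)
  map_id U := by
    apply RingCat.hom_ext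
    refine RingCon.Quotient.hom_ext (RingHom.ext fun t => ?_)
    exact congrArg (RingCon.mk' (idealSheaf T S U).ringCon)
      (congrArg (fun g : T.obj.obj U ⟶ T.obj.obj U => g t) (T.obj.map_id U))
  map_comp {U U' U''} f g := by
    apply RingCat.hom_ext
    refine RingCon.Quotient.hom_ext (RingHom.ext fun t => ?_)
    exact congrArg (RingCon.mk' (idealSheaf T S U'').ringCon)
      (congrArg (fun g : T.obj.obj U ⟶ T.obj.obj U'' => g t) (T.obj.map_comp f g))

/-- The quotient `T / I` by the two-sided ideal sheaf `I` generated by `S`: the sheaf associated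
with `U ↦ T(U) / I(U)`. -/
def quotSheaf : Sheaf (Opens.grothendieckTopology X) RingCat.{u} :=
  (presheafToSheaf (Opens.grothendieckTopology X) RingCat.{u}).obj (preQuot T S)

/-- The projection `T ⟶ T / I`. -/
def quotProj : T ⟶ quotSheaf T S where
  hom :=
    { app U := RingCat.ofHom (RingCon.mk' (idealSheaf T S U).ringCon)
      naturality _ _ _ := rfl } ≫ toSheafify (Opens.grothendieckTopology X) (preQuot T S)

end Ideals

end TwistedQuiver

end

open TwistedQuiver

/-! The $e_i$ are orthogonal idempotents with sum $1$, so a $\mathcal T$-module $\mathcal N$ splits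
as $\bigoplus_i e_i\mathcal N$, and a section $m$ of $\mathscr M_\alpha$, being equal to
$e_{h\alpha}\,m\,e_{t\alpha}$, acts through a map $\mathscr M_\alpha\otimes e_{t\alpha}\mathcal N\to
e_{h\alpha}\mathcal N$. Conversely such maps extend to an action of the tensor algebra by its
universal property. The only difficulty is that $\mathcal T$, the tensor products and the images are
objects of sheaf categories.

All of it is nevertheless checked on sections over open sets, which is why nothing is needed about
the $\mathscr M_\alpha$. The presheaf $U\mapsto\prod_i\mathcal E_i(U)$ is already a sheaf
(`repAb_isSheaf`), so sheafification does not change its sections (`unitSec_bijective`). A morphism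
out of a sheaf tensor product is determined by its pairings on sections (`tens_hom_ext`). The image
of $e_i$ is a retract of $\mathcal N$ (`image_ι_factor`), so its sections over $U$ are $e_i\mathcal
N(U)$. By the sheafification adjunction, linearity over $\mathcal T$ need only be checked over the
presheaf of tensor algebras, hence on generators (`sumSec_smul`). The two comparison maps are then
bijective on sections (`isIso_toFG_app`, `sumSec_bijective`).

For relations, restriction along $\pi$ is fully faithful because $\pi$ is locally surjective, and
its essential image consists of the modules annihilated by the generators of the ideal
(`essImage_restrictScalars_quotProj`). A relation $r$ with tail $i$ satisfies $re_i=r$, so $r$ kills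
$G(\mathcal E)$ as soon as it kills the summand $\mathcal E_i$ (`satisfies_iff`). Thus
$\mathrm{Rep}(\mathscr MQ,\mathcal R)$ is the preimage under $G$ of this essential image, and the
second equivalence follows formally from the first. -/

noncomputable section

namespace TwistedQuiver

/-! ### Sheafification of presheaves of modules, on sections -/

section SheafificationOfSheaves

variable {X : RingedSpace.{u, u}} {R₀ : (Opens X)ᵒᵖ ⥤ RingCat.{u}}
  {R : Sheaf (Opens.grothendieckTopology X) RingCat.{u}} (α : R₀ ⟶ R.obj)
  [Presheaf.IsLocallyInjective (Opens.grothendieckTopology X) α]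
  [Presheaf.IsLocallySurjective (Opens.grothendieckTopology X) α]

/-- The unit of the sheafification adjunction on sections. -/
def unitSec (P : PresheafOfModules.{u} R₀) (U : (Opens X)ᵒᵖ) :
    P.obj U →+ ((PresheafOfModules.sheafification α).obj P).val.obj U :=
  AddMonoidHom.mk' (fun s => ((PresheafOfModules.sheafificationAdjunction α).unit.app P).app U s)
    (map_add (((PresheafOfModules.sheafificationAdjunction α).unit.app P).app U).hom)

lemma unitSec_smul (P : PresheafOfModules.{u} R₀) (U : (Opens X)ᵒᵖ) (t : R₀.obj U)
    (s : P.obj U) : unitSec α P U (t • s) = (α.app U t : R.obj.obj U) • unitSec α P U s :=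
  (((PresheafOfModules.sheafificationAdjunction α).unit.app P).app U).hom.map_smul t s

lemma unitSec_res (P : PresheafOfModules.{u} R₀) {U U' : (Opens X)ᵒᵖ} (f : U ⟶ U')
    (s : P.obj U) : ((PresheafOfModules.sheafification α).obj P).val.map f (unitSec α P U s) =
      unitSec α P U' (P.map f s) :=
  (PresheafOfModules.naturality_apply
    ((PresheafOfModules.sheafificationAdjunction α).unit.app P) f s).symm

lemma unitSec_naturality {P Q : PresheafOfModules.{u} R₀} (f : P ⟶ Q) (U : (Opens X)ᵒᵖ)
    (s : P.obj U) : ((PresheafOfModules.sheafification α).map f).val.app U (unitSec α P U s) =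
      unitSec α Q U (f.app U s) :=
  (congrArg (fun g : P ⟶ _ => (g.app U).hom s)
    ((PresheafOfModules.sheafificationAdjunction α).unit.naturality f)).symm

/-- Sheafification does not change the sections of a presheaf of modules which is a sheaf. -/
lemma unitSec_bijective (P : PresheafOfModules.{u} R₀)
    (hP : Presheaf.IsSheaf (Opens.grothendieckTopology X) P.presheaf) (U : (Opens X)ᵒᵖ) :
    Function.Bijective (unitSec α P U) := by
  -- On underlying presheaves of abelian groups the unit is the usual map to the associated sheaf,
  -- an isomorphism when the source is a sheaf.
  have h := isIso_toSheafify (Opens.grothendieckTopology X) hP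
  exact (ConcreteCategory.isIso_iff_bijective
    ((toSheafify (Opens.grothendieckTopology X) P.presheaf).app U)).mp inferInstance

lemma homEquiv_symm_unitSec {P : PresheafOfModules.{u} R₀} {N : SheafOfModules.{u} R}
    (g : P ⟶ (PresheafOfModules.restrictScalars α).obj N.val) (U : (Opens X)ᵒᵖ)
    (s : P.obj U) :
    (((PresheafOfModules.sheafificationAdjunction α).homEquiv P N).symm g).val.app U
      (unitSec α P U s) = g.app U s := by
  have h := ((PresheafOfModules.sheafificationAdjunction α).homEquiv P N).apply_symm_apply g
  rw [Adjunction.homEquiv_unit] at h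
  exact congrArg (fun k : P ⟶ _ => (k.app U).hom s) h

/-- The forgetful functor to presheaves of abelian groups reflects isomorphisms, and there
isomorphisms are detected on sections. -/
lemma isIso_of_bijective {N N' : SheafOfModules.{u} R} (g : N ⟶ N')
    (h : ∀ U, Function.Bijective (g.val.app U)) : IsIso g := by
  have hg : IsIso ((SheafOfModules.forget R ⋙ PresheafOfModules.toPresheaf R.obj).map g) := by
    rw [NatTrans.isIso_iff_isIso_app]
    intro U
    rw [ConcreteCategory.isIso_iff_bijective]
    exact h U
  exact isIso_of_reflects_iso g (SheafOfModules.forget R ⋙ PresheafOfModules.toPresheaf R.obj)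

/-- The transpose composed with the unit is `g`. Since `P` is a sheaf, the unit is bijective on
sections, so bijectivity of `g` passes to the transpose. -/
lemma isIso_homEquiv_symm {P : PresheafOfModules.{u} R₀} {N : SheafOfModules.{u} R}
    (g : P ⟶ (PresheafOfModules.restrictScalars α).obj N.val)
    (hP : Presheaf.IsSheaf (Opens.grothendieckTopology X) P.presheaf)
    (h : ∀ U, Function.Bijective (g.app U)) :
    IsIso (((PresheafOfModules.sheafificationAdjunction α).homEquiv P N).symm g) := by
  refine isIso_of_bijective _ fun U => ?_
  rw [← Function.Bijective.of_comp_iff _ (unitSec_bijective α P hP U)]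
  have : (((PresheafOfModules.sheafificationAdjunction α).homEquiv P N).symm g).val.app U ∘
      unitSec α P U = g.app U := funext fun s => homEquiv_symm_unitSec α g U s
  rw [this]
  exact h U

lemma eq_of_locally_eq (N : SheafOfModules.{u} R) (U : (Opens X)ᵒᵖ) (s t : N.val.obj U)
    (h : ∀ x ∈ U.unop, ∃ (W : Opens X) (i : W ⟶ U.unop), x ∈ W ∧
      N.val.map i.op s = N.val.map i.op t) : s = t := by
  obtain ⟨U⟩ := U
  have hS : Presheaf.equalizerSieve (F := N.val.presheaf) s t ∈
      Opens.grothendieckTopology X U := by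
    intro x hx
    obtain ⟨W, i, hW, h⟩ := h x hx
    exact ⟨W, i, h, hW⟩
  apply N.isSheaf.isSeparated _ _ hS
  intro Y f hf
  exact hf

end SheafificationOfSheaves

/-- The images of `B` and `W` generate the ring. The integer constants of the free ring need no case
of their own: they come from integers in `B`. -/
lemma BimoduleTensorAlgebra.induction {B W : Type u} [Ring B] [AddCommGroup W] [Module B W]
    [Module Bᵐᵒᵖ W] {p : BimoduleTensorAlgebra B W → Prop} (hb : ∀ b, p (base B W b))
    (hw : ∀ w, p (incl B W w)) (hadd : ∀ x y, p x → p y → p (x + y))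
    (hmul : ∀ x y, p x → p y → p (x * y)) (x : BimoduleTensorAlgebra B W) : p x := by
  obtain ⟨x, rfl⟩ := RingQuot.mkRingHom_surjective _ x
  induction x using FreeAlgebra.induction with
  | grade0 n =>
    have h : algebraMap ℤ (FreeAlgebra ℤ (B ⊕ W)) n = n := by simp
    have h' : p (base B W n) := hb n
    rw [h, map_intCast]
    rwa [map_intCast] at h'
  | grade1 x =>
    cases x with
    | inl b => exact hb b
    | inr w => exact hw w
  | mul a b ha hb' => rw [map_mul]; exact hmul _ _ ha hb'
  | add a b ha hb' => rw [map_add]; exact hadd _ _ ha hb'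

/-! ### The sheaf property of the direct sum -/

section DirectSum

variable {V : Type u} [Quiver.{u} V] {X : RingedSpace.{u, u}} {M : Quiver.Total V → OMod X}

/-- The presheaf is a product of sheaves: compatible families are glued component by component. This
is what keeps the sections of $G(\mathcal E)$ explicit. -/
lemma repAb_isSheaf (E : TwistedRep M) :
    Presheaf.IsSheaf (Opens.grothendieckTopology X) (repAb E) := by
  rw [Presheaf.isSheaf_iff_isSheaf_forget _ _ (forget Ab), isSheaf_iff_isSheaf_of_type]
  intro U S hS x hx
  have h (i : V) := (isSheaf_iff_isSheaf_of_type _ _).mp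
    ((Presheaf.isSheaf_iff_isSheaf_forget _ _ (forget Ab)).mp (E.obj i).isSheaf) S hS
    (fun Y f hf => (show RepSec E (op Y) from x f hf) i)
    (fun Y₁ Y₂ Z g₁ g₂ f₁ f₂ h₁ h₂ e =>
      congrFun (show (_ : RepSec E (op Z)) = _ from hx g₁ g₂ h₁ h₂ e) i)
  choose t ht htu using h
  refine ⟨(t : RepSec E (op U)), fun Y f hf => funext fun i => ht i f hf, fun y hy => ?_⟩
  refine funext fun i => htu i ((show RepSec E (op U) from y) i) fun Y f hf => ?_
  exact congrFun (show (_ : RepSec E (op Y)) = _ from hy f hf) i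

end DirectSum

/-! ### Morphisms of modules and of tensor products, on sections -/

section Tensor

variable {X : RingedSpace.{u, u}}

lemma toSheafifyMod_lift {P : OPreMod X} {N : OMod X} (f : P ⟶ pre N) :
    toSheafifyMod P ≫ (sheafifyModLift f).val = f := by
  have h := ((PresheafOfModules.sheafificationAdjunction (R := structureSheaf X)
    (𝟙 (X.presheaf ⋙ forget₂ CommRingCat RingCat))).homEquiv P N).apply_symm_apply f
  rw [Adjunction.homEquiv_unit] at h
  exact h

lemma sheafifyMod_hom_ext {P : OPreMod X} {N : OMod X} {f g : sheafifyMod.obj P ⟶ N}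
    (h : toSheafifyMod P ≫ f.val = toSheafifyMod P ≫ g.val) : f = g := by
  apply ((PresheafOfModules.sheafificationAdjunction (R := structureSheaf X)
    (𝟙 (X.presheaf ⋙ forget₂ CommRingCat RingCat))).homEquiv P N).injective
  rw [Adjunction.homEquiv_unit, Adjunction.homEquiv_unit]
  exact h

/-- Morphisms out of `A ⊗ B` are determined by their pairings. -/
lemma tens_hom_ext {A B N : OMod X} {f g : tens A B ⟶ N}
    (h : ∀ U m s, pairing f U m s = pairing g U m s) : f = g := by
  refine sheafifyMod_hom_ext (PresheafOfModules.hom_ext fun U => ?_)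
  exact ModuleCat.MonoidalCategory.tensor_ext (fun m s => h U m s)

lemma onSec_comp {A B N : OMod X} (f : A ⟶ B) (g : B ⟶ N) (U : (Opens X)ᵒᵖ) (s : Sec A U) :
    onSec (f ≫ g) U s = onSec g U (onSec f U s) := rfl

lemma onSec_hom_ext {A B : OMod X} {f g : A ⟶ B} (h : ∀ U s, onSec f U s = onSec g U s) :
    f = g :=
  SheafOfModules.hom_ext (PresheafOfModules.hom_ext fun U =>
    ModuleCat.hom_ext (LinearMap.ext (h U)))

lemma isIso_of_onSec_bijective {A B : OMod X} (f : A ⟶ B)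
    (h : ∀ U, Function.Bijective (onSec f U)) : IsIso f :=
  isIso_of_bijective f h

end Tensor

/-! ### The complete system of orthogonal idempotents of $\mathcal B$ -/

section BaseIdem

variable {V : Type u} {X : RingedSpace.{u, u}}

lemma baseIdem_mul_self (i : V) (U : (Opens X)ᵒᵖ) :
    baseIdem (X := X) i U * baseIdem i U = baseIdem i U := by
  classical
  simp [baseIdem, ← Pi.single_mul]

lemma baseIdem_mul_of_ne {i j : V} (h : i ≠ j) (U : (Opens X)ᵒᵖ) :
    baseIdem (X := X) i U * baseIdem j U = 0 := by
  classical
  funext k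
  by_cases hk : k = i
  · subst hk; simp [baseIdem, h]
  · simp [baseIdem, hk]

lemma sum_baseIdem [Fintype V] (U : (Opens X)ᵒᵖ) : ∑ i : V, baseIdem (X := X) i U = 1 := by
  classical
  exact Finset.univ_sum_single (1 : BaseSec V X U)

end BaseIdem

/-! ### The submodules $e_i\mathcal N$ -/

section Idempotents

variable {V : Type u} [Quiver.{u} V] {X : RingedSpace.{u, u}} (M : Quiver.Total V → OMod X)
  (N : SheafOfModules.{u} (pathAlg M))

lemma onSec_idem (i : V) (U : (Opens X)ᵒᵖ) (s : Sec ((toOMod M).obj N) U) :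
    onSec (idem M N i) U s = secEnd M N U (ofBase M U (baseIdem i U)) s := rfl

lemma idem_comp_self (i : V) : idem M N i ≫ idem M N i = idem M N i :=
  onSec_hom_ext fun U s => by
    rw [onSec_comp, onSec_idem, onSec_idem, ← secEnd_mul, ← map_mul, baseIdem_mul_self]

/-- An idempotent splits through its image: between the epimorphism onto the image and the
monomorphism out of it, the claim becomes $e_i^2=e_i$. Consequently the image is a retract and can
be handled on sections without sheafifying. -/
lemma image_ι_factor (i : V) :
    image.ι (idem M N i) ≫ factorThruImage (idem M N i) = 𝟙 _ := by
  rw [← cancel_mono (image.ι (idem M N i)), ← cancel_epi (factorThruImage (idem M N i))]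
  simp only [Category.assoc, image.fac, Category.id_comp]
  rw [← Category.assoc, image.fac, idem_comp_self]

lemma image_ι_idem (i : V) : image.ι (idem M N i) ≫ idem M N i = image.ι (idem M N i) := by
  rw [← cancel_epi (factorThruImage (idem M N i)), ← Category.assoc, image.fac, idem_comp_self]

lemma onSec_factor_ι (i : V) (U : (Opens X)ᵒᵖ) (s : Sec (image (idem M N i)) U) :
    onSec (factorThruImage (idem M N i)) U (onSec (image.ι (idem M N i)) U s) = s :=
  congrArg (fun f => onSec f U s) (image_ι_factor M N i)

lemma onSec_ι_factor (i : V) (U : (Opens X)ᵒᵖ) (s : Sec ((toOMod M).obj N) U) :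
    onSec (image.ι (idem M N i)) U (onSec (factorThruImage (idem M N i)) U s) =
      secEnd M N U (ofBase M U (baseIdem i U)) s :=
  congrArg (fun f => onSec f U s) (image.fac (idem M N i))

lemma secEnd_onSec_ι (i : V) (U : (Opens X)ᵒᵖ) (s : Sec (image (idem M N i)) U) :
    secEnd M N U (ofBase M U (baseIdem i U)) (onSec (image.ι (idem M N i)) U s) =
      onSec (image.ι (idem M N i)) U s :=
  congrArg (fun f => onSec f U s) (image_ι_idem M N i)

lemma onSec_ι_injective (i : V) (U : (Opens X)ᵒᵖ) :
    Function.Injective (onSec (image.ι (idem M N i)) U) :=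
  Function.LeftInverse.injective (onSec_factor_ι M N i U)

/-- Sections of the image of $e_i$ are fixed by $e_i$, and $e_je_i=0$. -/
lemma onSec_factor_ι_of_ne {i j : V} (h : j ≠ i) (U : (Opens X)ᵒᵖ)
    (s : Sec (image (idem M N i)) U) :
    onSec (factorThruImage (idem M N j)) U (onSec (image.ι (idem M N i)) U s) = 0 := by
  apply onSec_ι_injective M N j U
  rw [onSec_ι_factor, ← secEnd_onSec_ι, ← secEnd_mul, ← map_mul, baseIdem_mul_of_ne h, map_zero,
    map_zero, map_zero]
  rfl

lemma pairing_act (a : Quiver.Total V) (U : (Opens X)ᵒᵖ) (m : Sec (M a) U)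
    (s : Sec ((toOMod M).obj N) U) :
    pairing (act M N a) U m s = secEnd M N U (ofArrowSingle M a U m) s :=
  congrArg (fun f : pre (M a) ⊗ pre ((toOMod M).obj N) ⟶ pre ((toOMod M).obj N) =>
    (f.app U).hom (m ⊗ₜ s)) (toSheafifyMod_lift (preAct M N a))

/-- The structure map of $F(\mathcal N)$ ends with multiplication by $e_{h\alpha}$, which is
harmless because $e_{h\alpha}m=m$. So it is the action of $\mathcal T$ itself. -/
lemma pairing_objF (a : Quiver.Total V) (U : (Opens X)ᵒᵖ) (m : Sec (M a) U)
    (s : Sec (image (idem M N a.left)) U) :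
    onSec (image.ι (idem M N a.right)) U (pairing ((objF M N).φ a) U m s) =
      secEnd M N U (ofArrowSingle M a U m) (onSec (image.ι (idem M N a.left)) U s) := by
  have h : ofBase M U (baseIdem a.right U) * ofArrowSingle M a U m = ofArrowSingle M a U m := by
    refine (ofArrow_smul M U _ _).symm.trans (congrArg (ofArrow M U) (funext fun b => ?_))
    change baseIdem a.right U b.right • arrowSingle M a U m b = arrowSingle M a U m b
    rw [arrowSingle_apply]
    by_cases hb : a = b
    · subst hb; simp [baseIdem]
    · simp [hb]
  change onSec _ U (pairing (tensMap (M a) (image.ι (idem M N a.left)) ≫ act M N a ≫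
      factorThruImage (idem M N a.right)) U m s) = _
  rw [pairing_tensMap_comp, pairing_comp, onSec_ι_factor, pairing_act, ← secEnd_mul, h]

end Idempotents

/-! ### The action of $e_i$ on the direct sum -/

section RepSingle

variable {V : Type u} [Quiver.{u} V] {X : RingedSpace.{u, u}}
  {M : Quiver.Total V → OMod X} (E : TwistedRep M)

lemma baseIdem_smul_repSingle (i : V) (U : (Opens X)ᵒᵖ) (s : RepSec E U) :
    (fun j => baseIdem i U j • s j) = repSingle E U i (s i) := by
  funext j
  rw [repSingle_apply]
  by_cases h : i = j
  · subst h; simp [baseIdem]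
  · simp [baseIdem, Ne.symm h, h]

end RepSingle

/-! ### The natural isomorphism $\mathrm{Id}\cong F\circ G$ -/

section UnitIso

variable {V : Type u} [Quiver.{u} V] [Fintype (Quiver.Total V)] {X : RingedSpace.{u, u}}
  {M : Quiver.Total V → OMod X}

/-- The identification of the sections of `⨁_i E_i` with those of `G(E)`. -/
def repToG (E : TwistedRep M) (U : (Opens X)ᵒᵖ) :
    RepSec E U →+ Sec ((toOMod M).obj ((functorG M).obj E)) U :=
  unitSec (toPathAlg M) (preG E) U

variable (E : TwistedRep M)

lemma repToG_bijective (U : (Opens X)ᵒᵖ) : Function.Bijective (repToG E U) :=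
  unitSec_bijective (toPathAlg M) (preG E) (repAb_isSheaf E) U

lemma secEnd_repToG (U : (Opens X)ᵒᵖ) (t : PathAlgSec M U) (s : RepSec E U) :
    secEnd M ((functorG M).obj E) U ((toPathAlg M).app U t) (repToG E U s) =
      repToG E U (t • s) :=
  (unitSec_smul (toPathAlg M) (preG E) U t s).symm

lemma secEnd_ofBase_repToG (U : (Opens X)ᵒᵖ) (b : BaseSec V X U) (s : RepSec E U) :
    secEnd M ((functorG M).obj E) U (ofBase M U b) (repToG E U s) =
      repToG E U (fun i => b i • s i) :=
  (secEnd_repToG E U _ s).trans (congrArg (repToG E U) (base_smul E U b s))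

lemma arrowAct_single (a : Quiver.Total V) (U : (Opens X)ᵒᵖ) (m : Sec (M a) U)
    (s : Sec (E.obj a.left) U) :
    arrowAct E U (arrowSingle M a U m) (repSingle E U a.left s) =
      repSingle E U a.right (pairing (E.φ a) U m s) := by
  rw [arrowAct_apply, Finset.sum_eq_single a]
  · rw [arrowSingle_apply, repSingle_apply]; simp
  · intro b _ hb
    rw [arrowSingle_apply]; simp [hb.symm]
  · simp

lemma secEnd_ofArrowSingle_inclG (a : Quiver.Total V) (U : (Opens X)ᵒᵖ) (m : Sec (M a) U)
    (s : Sec (E.obj a.left) U) :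
    secEnd M ((functorG M).obj E) U (ofArrowSingle M a U m) (inclG E a.left U s) =
      inclG E a.right U (pairing (E.φ a) U m s) :=
  (secEnd_repToG E U _ _).trans (congrArg (repToG E U)
    ((incl_smul E U _ _).trans (arrowAct_single E a U m s)))

/-- The inclusion of the summand `E_i` into `G(E)`. -/
def inclGHom (i : V) : E.obj i ⟶ (toOMod M).obj ((functorG M).obj E) where
  val :=
    { app U := ModuleCat.ofHom (R := OSec U) (X := Sec (E.obj i) U)
        (Y := Sec ((toOMod M).obj ((functorG M).obj E)) U)
        { toFun := fun s => repToG E U (repSingle E U i s)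
          map_add' := fun s s' => by rw [map_add, map_add]
          map_smul' := fun r s => by
            refine Eq.trans ?_ (secEnd_ofBase_repToG E U (fun _ => r) _).symm
            exact congrArg (repToG E U) (baseAct_repSingle E U (fun _ => r) i s).symm }
      naturality {U U'} f := by
        ext s
        exact (congrArg (repToG E U') (repRes_repSingle E f i s).symm).trans
          (unitSec_res (toPathAlg M) (preG E) f _).symm }

lemma onSec_inclGHom (i : V) (U : (Opens X)ᵒᵖ) (s : Sec (E.obj i) U) :
    onSec (inclGHom E i) U s = repToG E U (repSingle E U i s) := rfl

/-- On the summand $\mathcal E_{t\alpha}$ of $G(\mathcal E)$ the action of $\mathscr M_\alpha$ is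
$\varphi_\alpha$ by construction. Comparing pairings turns this into an identity of sheaf morphisms,
which gives the compatibility of `toFG` with the arrows. -/
lemma φ_inclGHom (a : Quiver.Total V) :
    E.φ a ≫ inclGHom E a.right =
      tensMap (M a) (inclGHom E a.left) ≫ act M ((functorG M).obj E) a :=
  tens_hom_ext fun U m s => by
    rw [pairing_comp, pairing_tensMap_comp, pairing_act]
    exact (secEnd_ofArrowSingle_inclG E a U m s).symm

lemma inclGHom_idem (i : V) :
    inclGHom E i ≫ idem M ((functorG M).obj E) i = inclGHom E i :=
  onSec_hom_ext fun U s => by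
    rw [onSec_comp, onSec_idem, onSec_inclGHom]
    refine (secEnd_ofBase_repToG E U _ _).trans (congrArg (repToG E U) ?_)
    rw [baseIdem_smul_repSingle, repSingle_apply]; simp

lemma inclGHom_naturality {E E' : TwistedRep M} (f : E ⟶ E') (i : V) :
    inclGHom E i ≫ (toOMod M).map ((functorG M).map f) = f.app i ≫ inclGHom E' i :=
  onSec_hom_ext fun U s =>
    (unitSec_naturality (toPathAlg M) ((preGFunctor M).map f) U (repSingle E U i s)).trans
      (congrArg (repToG E' U) (repMap_repSingle f U i s))

/-- The morphism `E ⟶ F(G(E))`. -/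
def toFG : E ⟶ (functorF M).obj ((functorG M).obj E) where
  app i := inclGHom E i ≫ factorThruImage (idem M ((functorG M).obj E) i)
  comm a := by
    change E.φ a ≫ (inclGHom E a.right ≫ factorThruImage (idem M ((functorG M).obj E) a.right) :
        E.obj a.right ⟶ image (idem M ((functorG M).obj E) a.right)) =
      tensMap (M a) (inclGHom E a.left ≫ factorThruImage (idem M ((functorG M).obj E) a.left)) ≫
        tensMap (M a) (image.ι (idem M ((functorG M).obj E) a.left)) ≫
          act M ((functorG M).obj E) a ≫ factorThruImage (idem M ((functorG M).obj E) a.right)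
    -- On the right, projecting to the image at the tail and including back is $e_{t\alpha}$, which
    -- fixes the summand $\mathcal E_{t\alpha}$.
    rw [← Category.assoc, φ_inclGHom, ← Category.assoc (tensMap _ (_ ≫ _)), ← tensMap_comp,
      Category.assoc (inclGHom E a.left), image.fac, inclGHom_idem, Category.assoc]

lemma repToG_repSingle_injective (i : V) (U : (Opens X)ᵒᵖ) :
    Function.Injective (onSec (inclGHom E i) U) := fun s t h => by
  have h' := congrFun ((repToG_bijective E U).injective h) i
  rwa [repSingle_apply, repSingle_apply, dif_pos rfl, dif_pos rfl] at h'

/-- Inside $G(\mathcal E)$ the image of $e_i$ is exactly the summand $\mathcal E_i$. Both halves are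
checked after including the image in $G(\mathcal E)$, whose sections are families $(x_j)_j$. -/
lemma isIso_toFG_app (i : V) : IsIso ((toFG E).app i) := by
  refine isIso_of_onSec_bijective _ fun U => ⟨fun s t h => ?_, fun t => ?_⟩
  · apply repToG_repSingle_injective E i U
    have h' := congrArg (onSec (image.ι (idem M ((functorG M).obj E) i)) U) h
    have key (s : Sec (E.obj i) U) : onSec (image.ι (idem M ((functorG M).obj E) i)) U
        (onSec ((toFG E).app i) U s) = onSec (inclGHom E i) U s := by
      refine (onSec_ι_factor M ((functorG M).obj E) i U (onSec (inclGHom E i) U s)).trans ?_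
      exact congrArg (fun f => onSec f U s) (inclGHom_idem E i)
    rwa [key, key] at h'
  · obtain ⟨x, hx⟩ := (repToG_bijective E U).surjective
      (onSec (image.ι (idem M ((functorG M).obj E) i)) U t)
    -- Only the `i`-th component of `x` is needed: $e_i$ replaces `x` by that component and fixes
    -- `t`.
    refine ⟨x i, ?_⟩
    have h1 : onSec (inclGHom E i) U (x i) =
        onSec (image.ι (idem M ((functorG M).obj E) i)) U t := by
      rw [onSec_inclGHom, ← baseIdem_smul_repSingle, ← secEnd_ofBase_repToG, hx]
      exact secEnd_onSec_ι M ((functorG M).obj E) i U t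
    refine (congrArg (onSec (factorThruImage (idem M ((functorG M).obj E) i)) U) h1).trans ?_
    exact onSec_factor_ι M ((functorG M).obj E) i U t

/-- An isomorphism of representations from its components. -/
def TwistedRep.isoOfIsIso {E E' : TwistedRep M} (f : E ⟶ E') (h : ∀ i, IsIso (f.app i)) :
    E ≅ E' where
  hom := f
  inv :=
    { app i := inv (f.app i)
      comm a := by
        rw [IsIso.comp_inv_eq, Category.assoc, f.comm a, ← Category.assoc, ← tensMap_comp,
          IsIso.inv_hom_id, tensMap_id, Category.id_comp] }
  hom_inv_id := TwistedRep.hom_ext fun i => IsIso.hom_inv_id (f.app i)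
  inv_hom_id := TwistedRep.hom_ext fun i => IsIso.inv_hom_id (f.app i)

variable (M) in
/-- The natural isomorphism `Id ≅ F ∘ G`. -/
def unitIso : 𝟭 (TwistedRep M) ≅ functorG M ⋙ functorF M :=
  NatIso.ofComponents (fun E => TwistedRep.isoOfIsIso (toFG E) (isIso_toFG_app E))
    (fun {E E'} f => TwistedRep.hom_ext fun i => by
      change f.app i ≫ inclGHom E' i ≫ factorThruImage _ =
        (inclGHom E i ≫ factorThruImage _) ≫ mapF M ((functorG M).map f) i
      rw [Category.assoc, factor_mapF, ← Category.assoc, ← Category.assoc, inclGHom_naturality])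

end UnitIso

/-! ### The natural isomorphism $G\circ F\cong\mathrm{Id}$ -/

section Counit

variable {V : Type u} [Quiver.{u} V] {X : RingedSpace.{u, u}} (M : Quiver.Total V → OMod X)

lemma sum_arrowSingle [Fintype (Quiver.Total V)] (U : (Opens X)ᵒᵖ) (w : ArrowSec M U) :
    ∑ a, arrowSingle M a U (w a) = w := by
  classical
  exact Finset.univ_sum_single (f := (w : ∀ a, Sec (M a) U))

variable (N : SheafOfModules.{u} (pathAlg M))

/-- The right action of $\mathcal B$ on $\mathscr M_\alpha$ factors through the component at
$t\alpha$, where $e_i$ vanishes. -/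
lemma ofArrowSingle_mul_baseIdem_of_ne (a : Quiver.Total V) {i : V} (h : a.left ≠ i)
    (U : (Opens X)ᵒᵖ) (m : Sec (M a) U) :
    ofArrowSingle M a U m * ofBase M U (baseIdem i U) = 0 := by
  refine (ofArrow_op_smul M U _ _).symm.trans
    ((congrArg (ofArrow M U) (funext fun b => ?_)).trans (map_zero _))
  change baseIdem i U b.left • arrowSingle M a U m b = 0
  rw [arrowSingle_apply]
  by_cases hb : a = b
  · subst hb; simp [baseIdem, h]
  · simp [hb]

variable [Fintype V]

/-- The map `⨁_i e_i N ⟶ N` on sections. -/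
def sumSec (U : (Opens X)ᵒᵖ) : RepSec (objF M N) U →+ Sec ((toOMod M).obj N) U :=
  AddMonoidHom.mk' (fun s => ∑ i, onSec (image.ι (idem M N i)) U (s i)) (fun s t => by
    rw [← Finset.sum_add_distrib]
    exact Finset.sum_congr rfl fun i _ => map_add (onSec (image.ι (idem M N i)) U) (s i) (t i))

lemma sumSec_apply (U : (Opens X)ᵒᵖ) (s : RepSec (objF M N) U) :
    sumSec M N U s = ∑ i, onSec (image.ι (idem M N i)) U (s i) := rfl

lemma sumSec_repSingle (U : (Opens X)ᵒᵖ) (i : V) (s : Sec (image (idem M N i)) U) :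
    sumSec M N U (repSingle (objF M N) U i s) = onSec (image.ι (idem M N i)) U s := by
  rw [sumSec_apply, Finset.sum_eq_single i]
  · exact congrArg _ ((repSingle_apply (objF M N) U i s i).trans (dif_pos rfl))
  · intro j _ hj
    exact (congrArg _ ((repSingle_apply (objF M N) U i s j).trans (dif_neg hj.symm))).trans
      (map_zero (onSec (image.ι (idem M N j)) U))
  · simp

lemma sumSec_res {U U' : (Opens X)ᵒᵖ} (f : U ⟶ U') (s : RepSec (objF M N) U) :
    sumSec M N U' (repRes (objF M N) f s) = res ((toOMod M).obj N) f (sumSec M N U s) := by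
  rw [sumSec_apply, sumSec_apply, map_sum]
  exact Finset.sum_congr rfl fun i _ => onSec_res (image.ι (idem M N i)) f (s i)

/-- On $e_i\mathcal N$ a section $b$ of $\mathcal B$ acts as the scalar $b_i$, because
$be_i=b_ie_i$. -/
lemma sumSec_base_smul (U : (Opens X)ᵒᵖ) (b : BaseSec V X U) (s : RepSec (objF M N) U) :
    ∑ i, onSec (image.ι (idem M N i)) U (b i • (show Sec (image (idem M N i)) U from s i)) =
      secEnd M N U (ofBase M U b) (sumSec M N U s) := by
  rw [sumSec_apply, map_sum]
  refine Finset.sum_congr rfl fun i _ => ?_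
  have h : (fun _ => b i) * baseIdem i U = b * baseIdem (X := X) i U := by
    funext j
    by_cases hj : j = i
    · subst hj; rfl
    · simp [baseIdem, hj]
  refine (map_smul (onSec (image.ι (idem M N i)) U) (b i) (s i)).trans ?_
  -- Inserting $e_i$ in front of the section makes the identity `h` applicable on both sides.
  have e := (secEnd_onSec_ι M N i U (s i)).symm
  rw [toOMod_smul]
  refine (congrArg _ e).trans (Eq.trans ?_ (congrArg _ e).symm)
  rw [← secEnd_mul, ← secEnd_mul, ← map_mul, ← map_mul, h]

/-- Since $m=me_{t\alpha}$, only the summand at the tail contributes. -/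
lemma secEnd_ofArrowSingle_sumSec (a : Quiver.Total V) (U : (Opens X)ᵒᵖ) (m : Sec (M a) U)
    (s : RepSec (objF M N) U) :
    secEnd M N U (ofArrowSingle M a U m) (sumSec M N U s) =
      onSec (image.ι (idem M N a.right)) U (pairing ((objF M N).φ a) U m (s a.left)) := by
  refine Eq.trans ?_ (pairing_objF M N a U m (s a.left)).symm
  rw [sumSec_apply, map_sum, Finset.sum_eq_single a.left]
  · intro i _ hi
    refine (congrArg _ (secEnd_onSec_ι M N i U (s i)).symm).trans ?_
    rw [← secEnd_mul, ofArrowSingle_mul_baseIdem_of_ne M a hi.symm, map_zero]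
    rfl
  · simp

/-- The inverse is $n\mapsto(e_in)_i$. One composite is the identity by orthogonality of the $e_i$,
the other by $\sum_ie_i=1$, which is where finiteness of the vertex set enters. -/
lemma sumSec_bijective (U : (Opens X)ᵒᵖ) : Function.Bijective (sumSec M N U) := by
  refine Function.bijective_iff_has_inverse.mpr
    ⟨fun n i => onSec (factorThruImage (idem M N i)) U n, fun s => funext fun j => ?_,
      fun n => ?_⟩
  · change onSec (factorThruImage (idem M N j)) U (sumSec M N U s) = s j
    rw [sumSec_apply, map_sum, Finset.sum_eq_single j]
    · exact onSec_factor_ι M N j U (s j)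
    · intro i _ hi
      exact onSec_factor_ι_of_ne M N hi.symm U (s i)
    · simp
  · refine (Finset.sum_congr rfl fun i _ => onSec_ι_factor M N i U n).trans ?_
    -- The sum of the $e_in$ is the endomorphism $\sum_ie_i$ evaluated at `n`.
    refine (map_sum (AddMonoidHom.eval n) (fun i => secEnd M N U (ofBase M U (baseIdem i U)))
      Finset.univ).symm.trans ?_
    rw [← map_sum, ← map_sum, sum_baseIdem, map_one, map_one]
    rfl

variable [Fintype (Quiver.Total V)]

/-- Both actions are multiplicative and additive in `t`, so the generators suffice. Linearity over
the presheaf of tensor algebras is all that the sheafification adjunction asks for. -/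
lemma sumSec_smul (U : (Opens X)ᵒᵖ) (t : PathAlgSec M U) (s : RepSec (objF M N) U) :
    sumSec M N U (t • s) = secEnd M N U ((toPathAlg M).app U t) (sumSec M N U s) := by
  induction t using BimoduleTensorAlgebra.induction generalizing s with
  | hb b =>
    exact (congrArg (sumSec M N U) (base_smul (objF M N) U b s)).trans
      (sumSec_base_smul M N U b s)
  | hw w =>
    refine (congrArg (sumSec M N U) (incl_smul (objF M N) U w s)).trans ?_
    -- A section of $\bigoplus_\alpha\mathscr M_\alpha$ is the finite sum of its components, so each
    -- arrow can be treated separately.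
    have hw : (toPathAlg M).app U (BimoduleTensorAlgebra.incl _ _ w) =
        ∑ a, ofArrowSingle M a U (w a) := by
      refine (congrArg (ofArrow M U) (sum_arrowSingle M U w).symm).trans ?_
      exact map_sum (ofArrow M U) _ _
    rw [hw, map_sum, map_sum]
    refine Eq.trans (Finset.sum_congr rfl fun a _ => ?_)
      (map_sum (AddMonoidHom.eval (sumSec M N U s)) _ _).symm
    refine Eq.trans ?_ (secEnd_ofArrowSingle_sumSec M N a U (w a) s).symm
    exact sumSec_repSingle M N U a.right _
  | hadd x y hx hy =>
    rw [add_smul, map_add, hx, hy, ← secEnd_add_left]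
    exact congrArg (fun t => secEnd M N U t _) (map_add ((toPathAlg M).app U).hom x y).symm
  | hmul x y hx hy =>
    rw [mul_smul, hx, hy, ← secEnd_mul]
    exact congrArg (fun t => secEnd M N U t _) (map_mul ((toPathAlg M).app U).hom x y).symm

/-- The map `⨁_i e_i N ⟶ N` of modules over the presheaf of tensor algebras. -/
def sumHom : preG (objF M N) ⟶ (PresheafOfModules.restrictScalars (toPathAlg M)).obj N.val :=
  PresheafOfModules.homMk
    { app U := AddCommGrpCat.ofHom (sumSec M N U)
      naturality U U' f := by
        ext s
        exact sumSec_res M N f s }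
    (fun U r s => sumSec_smul M N U r s)

/-- The morphism `G(F(N)) ⟶ N`. -/
def fromGF : (functorG M).obj ((functorF M).obj N) ⟶ N :=
  ((PresheafOfModules.sheafificationAdjunction (toPathAlg M)).homEquiv
    (preG (objF M N)) N).symm (sumHom M N)

lemma isIso_fromGF : IsIso (fromGF M N) :=
  isIso_homEquiv_symm (toPathAlg M) (sumHom M N) (repAb_isSheaf (objF M N))
    (sumSec_bijective M N)

variable {N} in
lemma sumHom_naturality {N' : SheafOfModules.{u} (pathAlg M)} (g : N ⟶ N') :
    (preGFunctor M).map ((functorF M).map g) ≫ sumHom M N' =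
      sumHom M N ≫ (PresheafOfModules.restrictScalars (toPathAlg M)).map g.val := by
  refine PresheafOfModules.hom_ext fun U => ModuleCat.hom_ext (LinearMap.ext fun s => ?_)
  refine Eq.trans ?_ (map_sum (onSec ((toOMod M).map g) U)
    (fun i => onSec (image.ι (idem M N i)) U (show Sec (image (idem M N i)) U from s i)) _).symm
  exact Finset.sum_congr rfl fun i _ =>
    congrArg (fun f => onSec f U (show Sec (image (idem M N i)) U from s i)) (mapF_ι M g i)

/-- The natural isomorphism `G ∘ F ≅ Id`. -/
def counitIso : functorF M ⋙ functorG M ≅ 𝟭 (SheafOfModules.{u} (pathAlg M)) :=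
  NatIso.ofComponents (fun N => @asIso _ _ _ _ (fromGF M N) (isIso_fromGF M N))
    (fun {N N'} g => by
      -- Both sides are transposes under the sheafification adjunction, so naturality reduces to
      -- that of `sumHom`.
      refine Eq.trans ((PresheafOfModules.sheafificationAdjunction
        (toPathAlg M)).homEquiv_naturality_left_symm _ (sumHom M N')).symm ?_
      exact (congrArg _ (sumHom_naturality M g)).trans
        ((PresheafOfModules.sheafificationAdjunction
          (toPathAlg M)).homEquiv_naturality_right_symm (sumHom M N) g))

/-- `Rep(MQ)` is equivalent to the category of modules over the twisted path algebra. -/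
def repEquivalence : TwistedRep M ≌ SheafOfModules.{u} (pathAlg M) :=
  CategoryTheory.Equivalence.mk (functorG M) (functorF M) (unitIso M) (counitIso M)

end Counit

/-! ### Modules over the quotient by an ideal sheaf generated by global sections -/

section Quotient

variable {X : RingedSpace.{u, u}} (T : Sheaf (Opens.grothendieckTopology X) RingCat.{u})
  (S : Set (T.obj.obj (op ⊤)))

/-- The projections `T(U) ⟶ T(U) / I(U)`. -/
def toPreQuot : T.obj ⟶ preQuot T S where
  app U := RingCat.ofHom (RingCon.mk' (idealSheaf T S U).ringCon)

instance : Presheaf.IsLocallySurjective (Opens.grothendieckTopology X) (toPreQuot T S) :=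
  Presheaf.isLocallySurjective_of_surjective _ _ fun _ => RingCon.mk'_surjective _

instance : Presheaf.IsLocallySurjective (Opens.grothendieckTopology X) (quotProj T S).hom :=
  inferInstanceAs (Presheaf.IsLocallySurjective (Opens.grothendieckTopology X)
    (toPreQuot T S ≫ toSheafify (Opens.grothendieckTopology X) (preQuot T S)))

/-- The canonical map from the presheaf `U ↦ T(U) / I(U)` to `T / I`. -/
def toQuotSheaf : preQuot T S ⟶ (quotSheaf T S).obj :=
  toSheafify (Opens.grothendieckTopology X) (preQuot T S)

instance : Presheaf.IsLocallyInjective (Opens.grothendieckTopology X) (toQuotSheaf T S) :=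
  inferInstanceAs (Presheaf.IsLocallyInjective (Opens.grothendieckTopology X)
    (toSheafify (Opens.grothendieckTopology X) (preQuot T S)))

instance : Presheaf.IsLocallySurjective (Opens.grothendieckTopology X) (toQuotSheaf T S) :=
  inferInstanceAs (Presheaf.IsLocallySurjective (Opens.grothendieckTopology X)
    (toSheafify (Opens.grothendieckTopology X) (preQuot T S)))

lemma quotProj_apply (U : (Opens X)ᵒᵖ) (t : T.obj.obj U) :
    (quotProj T S).hom.app U t =
      (toQuotSheaf T S).app U (RingCon.mk' (idealSheaf T S U).ringCon t) := rfl

/-- Every section of $\mathcal T/\mathcal I$ lifts locally to $\mathcal T$. A $\mathcal T$-linear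
map therefore respects the action of $\mathcal T/\mathcal I$ locally, hence globally, since its
target is a sheaf. -/
instance restrictScalars_quotProj_full :
    (SheafOfModules.restrictScalars.{u} (quotProj T S)).Full where
  map_surjective {N N'} g := by
    obtain ⟨f, hf⟩ := (PresheafOfModules.restrictHomEquivOfIsLocallySurjective
      (M₁ := N.val) (quotProj T S).hom N'.isSheaf).surjective g.val
    exact ⟨⟨f⟩, SheafOfModules.hom_ext hf⟩

instance restrictScalars_quotProj_faithful :
    (SheafOfModules.restrictScalars.{u} (quotProj T S)).Faithful where
  map_injective h := SheafOfModules.hom_ext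
    ((PresheafOfModules.restrictScalars (quotProj T S).hom).map_injective
      (congrArg SheafOfModules.Hom.val h))

/-- The modules on which the restrictions of the sections in `S` act as zero. -/
def AnnihilatedBy : ObjectProperty (SheafOfModules.{u} T) := fun N =>
  ∀ t ∈ S, ∀ (U : (Opens X)ᵒᵖ) (s : N.val.obj U),
    (T.obj.map (homOfLE le_top : U.unop ⟶ ⊤).op t : T.obj.obj U) • s = 0

variable {T S}

/-- Over each open set the annihilator is the kernel of the action, a two-sided ideal; containing
the generators, it contains the ideal that they span. The ideal sheaf is locally of this form, and
vanishing of a section of `N` is local. -/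
lemma AnnihilatedBy.smul_eq_zero {N : SheafOfModules.{u} T} (h : AnnihilatedBy T S N)
    {U : (Opens X)ᵒᵖ} {t : T.obj.obj U} (ht : t ∈ idealSheaf T S U) (s : N.val.obj U) :
    t • s = 0 := by
  have hpre (W : (Opens X)ᵒᵖ) (r : T.obj.obj W) (hr : r ∈ preIdeal T S W) (s : N.val.obj W) :
      r • s = 0 := by
    have hle : preIdeal T S W ≤
        TwoSidedIdeal.ker (Module.toAddMonoidEnd (T.obj.obj W) (N.val.obj W)) := by
      refine TwoSidedIdeal.span_le.mpr ?_
      rintro _ ⟨r, hr, rfl⟩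
      exact (TwoSidedIdeal.mem_ker _).mpr (AddMonoidHom.ext fun s => h r hr W s)
    exact congrArg (fun f : AddMonoid.End _ => f s) ((TwoSidedIdeal.mem_ker _).mp (hle hr))
  refine eq_of_locally_eq N U _ _ fun x hx => ?_
  obtain ⟨W, i, hW, hi⟩ := (mem_idealSheaf T S U t).mp ht x hx
  refine ⟨W, i, hW, ?_⟩
  exact (N.val.map_smul i.op t s).trans ((hpre _ _ hi _).trans (map_zero (N.val.map i.op).hom).symm)

/-- The action of `T(U) / I(U)` on the sections of a module annihilated by `S`. -/
def AnnihilatedBy.act {N : SheafOfModules.{u} T} (h : AnnihilatedBy T S N) (U : (Opens X)ᵒᵖ) :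
    (preQuot T S).obj U →+* AddMonoid.End (N.val.presheaf.obj U) :=
  RingCon.lift (idealSheaf T S U).ringCon
    (Module.toAddMonoidEnd (T.obj.obj U) (N.val.obj U)) (by
      intro a b hab
      have h0 := fun s => h.smul_eq_zero ((TwoSidedIdeal.rel_iff _ a b).mp hab) s
      refine AddMonoidHom.ext fun s => ?_
      exact sub_eq_zero.mp ((sub_smul a b s).symm.trans (h0 s)))

/-- The presheaf of modules over `U ↦ T(U) / I(U)` given by a module annihilated by `S`. -/
def AnnihilatedBy.preMod {N : SheafOfModules.{u} T} (h : AnnihilatedBy T S N) :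
    PresheafOfModules.{u} (preQuot T S) :=
  letI (U : (Opens X)ᵒᵖ) : Module ((preQuot T S).obj U) (N.val.presheaf.obj U) :=
    Module.compHom _ (h.act U)
  PresheafOfModules.ofPresheaf N.val.presheaf (fun U U' f r s => by
    obtain ⟨t, rfl⟩ := RingCon.mk'_surjective _ r
    exact N.val.map_smul f t s)

lemma AnnihilatedBy.mk_smul {N : SheafOfModules.{u} T} (h : AnnihilatedBy T S N)
    (U : (Opens X)ᵒᵖ) (t : T.obj.obj U) (s : N.val.obj U) :
    (show (preQuot T S).obj U from RingCon.mk' (idealSheaf T S U).ringCon t) •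
      (show h.preMod.obj U from s) = (show h.preMod.obj U from t • s) := rfl

/-- The comparison of a module annihilated by `S` with the restriction of scalars of the
corresponding module over `T / I`. -/
def AnnihilatedBy.toRestrict {N : SheafOfModules.{u} T} (h : AnnihilatedBy T S N) :
    N ⟶ (SheafOfModules.restrictScalars (quotProj T S)).obj
      ((PresheafOfModules.sheafification (toQuotSheaf T S)).obj h.preMod) where
  val := PresheafOfModules.homMk
    { app U := AddCommGrpCat.ofHom (unitSec (toQuotSheaf T S) h.preMod U)
      naturality U U' f := by
        ext s
        exact (unitSec_res (toQuotSheaf T S) h.preMod f s).symm }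
    (fun U t s => (congrArg (unitSec (toQuotSheaf T S) h.preMod U) (h.mk_smul U t s).symm).trans
      (unitSec_smul (toQuotSheaf T S) h.preMod U _ s))

/-- The module over the presheaf quotient has the same underlying presheaf as `N`, already a sheaf,
so passing to $\mathcal T/\mathcal I$ keeps the sections. -/
lemma AnnihilatedBy.isIso_toRestrict {N : SheafOfModules.{u} T} (h : AnnihilatedBy T S N) :
    IsIso h.toRestrict :=
  isIso_of_bijective _ fun U => unitSec_bijective (toQuotSheaf T S) h.preMod N.isSheaf U

lemma annihilatedBy_restrictScalars (N : SheafOfModules.{u} (quotSheaf T S)) :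
    AnnihilatedBy T S ((SheafOfModules.restrictScalars (quotProj T S)).obj N) := by
  intro t ht U s
  have hmem : T.obj.map (homOfLE le_top : U.unop ⟶ ⊤).op t ∈ idealSheaf T S U :=
    -- The restricted generator lies in the presheaf ideal over `U` itself, so `U` serves as the
    -- neighbourhood of each point.
    (mem_idealSheaf T S U _).mpr fun x hx => ⟨U.unop, 𝟙 _, hx,
      preIdeal_res T S (𝟙 U) (TwoSidedIdeal.subset_span ⟨t, ht, rfl⟩)⟩
  have h0 : (quotProj T S).hom.app U (T.obj.map (homOfLE le_top : U.unop ⟶ ⊤).op t) = 0 := by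
    rw [quotProj_apply]
    have : RingCon.mk' (idealSheaf T S U).ringCon
        (T.obj.map (homOfLE le_top : U.unop ⟶ ⊤).op t) = 0 :=
      (RingCon.eq _).mpr ((TwoSidedIdeal.mem_iff _ _).mp hmem)
    rw [this]
    exact map_zero ((toQuotSheaf T S).app U).hom
  exact (congrArg (fun q : (quotSheaf T S).obj.obj U => q • (show N.val.obj U from s)) h0).trans
    (zero_smul _ _)

variable (T S) in
/-- The modules over `T / I` are the modules over `T` annihilated by the generators of `I`. -/
lemma essImage_restrictScalars_quotProj :
    (SheafOfModules.restrictScalars.{u} (quotProj T S)).essImage = AnnihilatedBy T S := by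
  ext N
  refine ⟨fun ⟨N', ⟨e⟩⟩ t ht U s => ?_, fun h => ⟨_, ⟨(@asIso _ _ _ _ _ h.isIso_toRestrict).symm⟩⟩⟩
  -- Annihilation is transported along the isomorphism: vanishing may be tested after the injective
  -- map `e.inv`.
  have hinj : Function.LeftInverse (e.hom.val.app U) (e.inv.val.app U) := fun s =>
    congrArg (fun f : N ⟶ N => (f.val.app U).hom s) e.inv_hom_id
  apply hinj.injective
  refine ((e.inv.val.app U).hom.map_smul _ s).trans ?_
  exact (annihilatedBy_restrictScalars N' t ht U _).trans (map_zero (e.inv.val.app U).hom).symm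

end Quotient

/-! ### Relations as annihilation conditions -/

section Relations

variable {V : Type u} [Quiver.{u} V] {X : RingedSpace.{u, u}} (M : Quiver.Total V → OMod X)

lemma sumAddHom_mul_eq_self {ι : Type*} [DecidableEq ι] {β : ι → Type*}
    [∀ i, AddCommGroup (β i)] {A : Type*} [Ring A] (φ : ∀ i, β i →+ A) (e : A)
    (h : ∀ i m, φ i m * e = φ i m) (f : Π₀ i, β i) :
    DFinsupp.sumAddHom φ f * e = DFinsupp.sumAddHom φ f := by
  refine (DFunLike.congr_fun (DFinsupp.comp_sumAddHom (AddMonoidHom.mulRight e) φ) f).trans ?_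
  congr 2
  exact funext fun i => AddMonoidHom.ext (h i)

/-- Right multiplication by `e_i` on the path algebra. -/
def mulIdem (i : V) : SheafOfModules.unit (pathAlg M) ⟶ SheafOfModules.unit (pathAlg M) :=
  (SheafOfModules.unit (pathAlg M)).unitHomEquiv.symm
    (PresheafOfModules.sectionsMk (fun U => ofBase M U (baseIdem i U)) (fun _ _ f =>
      (ofBase_res M f _).trans (congrArg _ (baseRes_baseIdem i f))))

lemma onSec_mulIdem (i : V) (U : (Opens X)ᵒᵖ) (t : (pathAlg M).obj.obj U) :
    onSec ((toOMod M).map (mulIdem M i)) U t = t * ofBase M U (baseIdem i U) := rfl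

/-- Right multiplication by $e_i$ is left $\mathcal T$-linear, so it commutes with prepending an
arrow on the left. By induction on the path everything reduces to the trivial path, where the claim
is $e_ie_i=e_i$. -/
lemma prePathIncl_mulIdem {i j : V} (p : Quiver.Path i j) :
    prePathIncl M p ≫ ((toOMod M).map (mulIdem M i)).val = prePathIncl M p := by
  induction p with
  | nil =>
    apply (pre (pathAlgMod M)).unitHomEquiv.injective
    refine PresheafOfModules.sections_ext _ _ fun U => ?_
    -- A map out of $\mathcal O_X$ is determined by the image of $1$, here $e_i$.
    have h1 : (vertexIncl M i).app U (1 : OSec U) = ofBase M U (baseIdem i U) :=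
      congrArg (fun s : (pre (pathAlgMod M)).sections => s.eval U)
        ((pre (pathAlgMod M)).unitHomEquiv.apply_symm_apply _)
    refine (congrArg (onSec ((toOMod M).map (mulIdem M i)) U) h1).trans (Eq.trans ?_ h1.symm)
    refine (onSec_mulIdem M i U (ofBase M U (baseIdem i U))).trans ?_
    rw [← map_mul, baseIdem_mul_self]
  | cons p e ih =>
    change ((pre (M ⟨_, _, e⟩) ◁ prePathIncl M p) ≫ preAct M _ ⟨_, _, e⟩) ≫ _ =
      (pre (M ⟨_, _, e⟩) ◁ prePathIncl M p) ≫ preAct M _ ⟨_, _, e⟩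
    rw [Category.assoc, preAct_naturality, ← Category.assoc, ← MonoidalCategory.whiskerLeft_comp,
      ih]

lemma pathIncl_mulIdem {i j : V} (p : Quiver.Path i j) :
    pathIncl M p ≫ (toOMod M).map (mulIdem M i) = pathIncl M p :=
  (sheafifyModLift_naturality_right _ _).symm.trans
    (congrArg sheafifyModLift (prePathIncl_mulIdem M p))

lemma pathSec_mul_ofBase {i j : V} (p : Quiver.Path i j) (U : (Opens X)ᵒᵖ)
    (m : Sec (pathMod M p) U) :
    pathSec M p U m * ofBase M U (baseIdem i U) = pathSec M p U m :=
  congrArg (fun f => onSec f U m) (pathIncl_mulIdem M p)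

variable {M}

-- All paths in a relation start at its tail $i$, so each summand, and hence the sum, absorbs $e_i$
-- on the right.
open scoped Classical in
lemma Relation.toSection_mul_ofBase (r : Relation M) :
    r.toSection * ofBase M _ (baseIdem r.src _) = r.toSection :=
  sumAddHom_mul_eq_self _ _ (fun p m => pathSec_mul_ofBase M p.1 (op ⊤) m) r.coeff

variable [Fintype (Quiver.Total V)]

/-- Satisfying a relation tests its action on the summand at its tail only. Since $re_i=r$, the
action of $r$ on any section of $G(\mathcal E)$ depends only on the component at $i$, so the test is
enough. -/
lemma satisfies_iff (R : Set (Relation M)) (E : TwistedRep M) :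
    Satisfies R E ↔ AnnihilatedBy (pathAlg M) (Relation.toSection '' R) ((functorG M).obj E) := by
  refine ⟨?_, fun h r hr U s => h _ ⟨r, hr, rfl⟩ U _⟩
  rintro h _ ⟨r, hr, rfl⟩ U x
  obtain ⟨y, rfl⟩ := (repToG_bijective E U).surjective x
  have hmul : (pathAlg M).obj.map (homOfLE le_top : U.unop ⟶ ⊤).op r.toSection *
      ofBase M U (baseIdem r.src U) =
        (pathAlg M).obj.map (homOfLE le_top : U.unop ⟶ ⊤).op r.toSection := by
    conv_rhs => rw [← r.toSection_mul_ofBase, map_mul, ofBase_res, baseRes_baseIdem]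
  rw [← hmul]
  refine (secEnd_mul M ((functorG M).obj E) U _ _ (repToG E U y)).trans ?_
  rw [secEnd_ofBase_repToG, baseIdem_smul_repSingle]
  exact h r hr U (y r.src)

end Relations

/-! ### Restricting an equivalence to the preimage of an essential image -/

section EssentialImage

open Functor

/-- Given an equivalence `e : C ≌ D` and a fully faithful functor `F : D' ⥤ D`, the full
subcategory of the objects of `C` sent by `e` to the essential image of `F` is equivalent
to `D'`. -/
def equivalenceOfEssImage {C D D' : Type*} [Category* C] [Category* D] [Category* D']
    (e : C ≌ D) (F : D' ⥤ D) [F.Full] [F.Faithful] {P : ObjectProperty C}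
    (h : F.essImage.inverseImage e.functor = P) : P.FullSubcategory ≌ D' :=
  (e.congrFullSubcategory h).trans (asEquivalence F.toEssImage).symm

variable {C D D' : Type*} [Category* C] [Category* D] [Category* D']
    (e : C ≌ D) (F : D' ⥤ D) [F.Full] [F.Faithful] {P : ObjectProperty C}
    (h : F.essImage.inverseImage e.functor = P)

/-- The equivalence `equivalenceOfEssImage` is compatible with the inclusion and with `F`. -/
def equivalenceOfEssImageFunctorIso :
    (equivalenceOfEssImage e F h).functor ⋙ F ≅ P.ι ⋙ e.functor :=
  Functor.associator _ _ _ ≪≫ isoWhiskerLeft _ (isoWhiskerLeft _ F.toEssImageCompι.symm ≪≫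
    (Functor.associator _ _ _).symm ≪≫
    isoWhiskerRight (asEquivalence F.toEssImage).counitIso _ ≪≫ Functor.leftUnitor _) ≪≫
    ObjectProperty.liftCompιIso _ _ _

/-- The inverse of `equivalenceOfEssImage` is compatible with the inclusion and with `F`. -/
def equivalenceOfEssImageInverseIso :
    (equivalenceOfEssImage e F h).inverse ⋙ P.ι ≅ F ⋙ e.inverse :=
  Functor.associator _ _ _ ≪≫ isoWhiskerLeft _ (ObjectProperty.liftCompιIso _ _ _) ≪≫
    (Functor.associator _ _ _).symm ≪≫ isoWhiskerRight F.toEssImageCompι _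

end EssentialImage

end TwistedQuiver
end

open TwistedQuiver

/-! ### The theorem -/

theorem mainTheorem5 {V : Type u} [Quiver.{u} V] [Finite V] [Fintype (Quiver.Total V)]
    (X : RingedSpace.{u, u}) (M : Quiver.Total V → OMod X) :
    (∃ e : TwistedRep M ≌ SheafOfModules.{u} (pathAlg M),
      e.functor = functorG M ∧ e.inverse = functorF M) ∧
    ∀ R : Set (Relation M),
      (SheafOfModules.restrictScalars.{u}
        (quotProj (pathAlg M) (Relation.toSection '' R))).Full ∧
      (SheafOfModules.restrictScalars.{u}
        (quotProj (pathAlg M) (Relation.toSection '' R))).Faithful ∧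
      ∃ e : RepWithRelations R ≌
          SheafOfModules.{u} (quotSheaf (pathAlg M) (Relation.toSection '' R)),
        Nonempty (e.functor ⋙ SheafOfModules.restrictScalars
            (quotProj (pathAlg M) (Relation.toSection '' R)) ≅
          (Satisfies R).ι ⋙ functorG M) ∧
        Nonempty (e.inverse ⋙ (Satisfies R).ι ≅
          SheafOfModules.restrictScalars (quotProj (pathAlg M) (Relation.toSection '' R)) ⋙
            functorF M) := by
  have : Fintype V := Fintype.ofFinite V
  -- `Equivalence.mk` adjusts only the unit to obtain the triangle identities and keeps both
  -- functors, so they agree definitionally with $G$ and $F$.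
  refine ⟨⟨repEquivalence M, rfl, rfl⟩, fun R => ⟨inferInstance, inferInstance, ?_⟩⟩
  have h : (SheafOfModules.restrictScalars.{u}
      (quotProj (pathAlg M) (Relation.toSection '' R))).essImage.inverseImage
        (repEquivalence M).functor = Satisfies R := by
    rw [essImage_restrictScalars_quotProj]
    ext E
    exact (satisfies_iff R E).symm
  exact ⟨equivalenceOfEssImage (repEquivalence M) _ h,
    ⟨equivalenceOfEssImageFunctorIso (repEquivalence M) _ h⟩,
    ⟨equivalenceOfEssImageInverseIso (repEquivalence M) _ h⟩⟩
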